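/- Let $\mathbb{F}$ be a finite field with $q$ elements, $n\ge 0$, and $G=\mathrm{GL}(n,q)$. Let $F$ be a field of characteristic $p>0$ with $p\nmid q$, and let $$m=m(p,q)=\min\{\,i>1 : 1+q+\cdots+q^{i-1}\equiv 0 \pmod p\,\}.$$ For $k\in\mathbb{Z}$ let $M^n_k$ be the $FG$-permutation module with basis the set of $k$-dimensional subspaces of $\mathbb{F}^n$ (so $M^n_k=0$ unless $0\le k\le n$). Let $\partial$ be the $F$-linear map on $\bigoplus_k M^n_k$ that sends each subspace $x$ to the sum of all subspaces of codimension $1$ in $x$. For $0<i<m$ define the incidence homology, an $FG$-module, by $$H^n_{k,i}=(\ker\partial^{i}\cap M^n_k)\big/\partial^{m-i}(M^n_{k+m-i}).$$ Call $(k,i)$ a middle index for $n$ if $0\le k\le n$, $0<i<m$ and $n<2k+m-i<n+m$. The Grothendieck ring of finite-dimensional $FG$-modules is the free abelian group on their isomorphism classes modulo the relations $[B]=[A]+[C]$ for all short exact sequences $0\to A\to B\to C\to 0$, with product induced by $\otimes_F$. The Burnside ring of $G$ over $F$ is its subring generated by the classes of the permutation modules $FX$ on finite $G$-sets $X$. Let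 $(k,i)$ be a middle index for $n$. Then only finitely many terms in the sums below are non-zero, and the following hold. 1. (Trace formula) The class $[H^n_{k,i}]$ lies in the Burnside ring of $G$ over $F$, and $$[H^n_{k,i}]=\sum_{t\in\mathbb{Z}}[M^n_{k+tm}]-\sum_{t\in\mathbb{Z}}[M^n_{k-i+tm}].$$ 2. (Brauer character) Let $K$ be a field of characteristic $0$ (for example $\mathbb{C}$), and let $\theta$ be an injective homomorphism from the group of roots of unity of an algebraic closure $\overline F$ of $F$ into $K^\times$. Let $\chi(\,\cdot\,,H)$ denote the Brauer character of an $FG$-module $H$ with respect to $\theta$: at a $p$-regular element $g$ (one of order prime to $p$) it is the sum of the values of $\theta$ at the eigenvalues of $g$ on $\overline F\otimes_F H$, counted with multiplicity. Then for every $p$-regular $g\in G$ $$\chi(g,H^n_{k,i})=\sum_{t\in\mathbb{Z}}\big(\pi_{k+tm}(g)-\pi_{k-i+tm}(g)\big),$$ where $\pi_k(g)$ is the number of $k$-dimensional subspaces of $\mathbb{F}^n$ stabilized by $g$. -/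

import Mathlib

open CategoryTheory

universe u v w

noncomputable section

/-! ### Finite-dimensional representations: Grothendieck ring and Burnside ring -/

section Grothendieck

/-- The relations `[B] - [A] - [C]`, one for every short exact sequence `0 → A → B → C → 0` of
finite-dimensional `F`-representations of `G`, in the free abelian group on the isomorphism
classes of such representations. -/
def shortExactRelations (F : Type u) (G : Type v) [Field F] [Group G] :
    Set (FreeAbelianGroup (Skeleton (FDRep F G))) :=
  {z | ∃ (A B C : FDRep F G) (f : A →ₗ[F] B) (h : B →ₗ[F] C),
    (∀ g a, f (A.ρ g a) = B.ρ g (f a)) ∧ (∀ g b, h (B.ρ g b) = C.ρ g (h b)) ∧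
    Function.Injective f ∧ Function.Exact f h ∧ Function.Surjective h ∧
    z = FreeAbelianGroup.of (toSkeleton B) - FreeAbelianGroup.of (toSkeleton A)
      - FreeAbelianGroup.of (toSkeleton C)}

/-- The Grothendieck ring of finite-dimensional `F`-representations of `G`: the free abelian group
on isomorphism classes, with product induced by the tensor product, modulo short exact
sequences. -/
abbrev GrothendieckRing (F : Type u) (G : Type v) [Field F] [Group G] : Type _ :=
  FreeAbelianGroup (Skeleton (FDRep F G)) ⧸ Ideal.span (shortExactRelations F G)

/-- The class of a finite-dimensional representation in the Grothendieck ring. -/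
def repClass {F V : Type u} {G : Type v} [Field F] [Group G] [AddCommGroup V] [Module F V]
    [FiniteDimensional F V] (ρ : Representation F G V) : GrothendieckRing F G :=
  Ideal.Quotient.mk _ (FreeAbelianGroup.of (toSkeleton (FDRep.of ρ)))

/-- The `F`-vector space `F X` with basis `X`. -/
def PermModule (F : Type v) (X : Type w) [Field F] : Type (max v w) := X →₀ F

instance (F : Type v) (X : Type w) [Field F] : AddCommGroup (PermModule F X) :=
  Finsupp.instAddCommGroup

instance (F : Type v) (X : Type w) [Field F] : Module F (PermModule F X) :=
  Finsupp.module X F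

/-- The basis `X` of `F X`. -/
def permBasis (F : Type v) (X : Type w) [Field F] : Module.Basis X F (PermModule F X) :=
  Finsupp.basisSingleOne

instance (F : Type v) (X : Type w) [Field F] [Finite X] : FiniteDimensional F (PermModule F X) :=
  (permBasis F X).finiteDimensional_of_finite

/-- The permutation representation of `G` on the space `F X` with basis `X`, for an action of `G`
on `X` given as a homomorphism to the permutations of `X`. -/
def permRep (F : Type*) {G X : Type*} [Field F] [Group G] (a : G →* Equiv.Perm X) :
    Representation F G (PermModule F X) where
  toFun g := (permBasis F X).constr F fun x => permBasis F X (a g x)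
  map_one' := (permBasis F X).ext fun x => by simp
  map_mul' g h := (permBasis F X).ext fun x => by simp

lemma permRep_apply_basis {F G X : Type*} [Field F] [Group G] (a : G →* Equiv.Perm X) (g : G)
    (x : X) : permRep F a g (permBasis F X x) = permBasis F X (a g x) :=
  (permBasis F X).constr_basis F _ x

/-- The Burnside ring of `G` over `F`: the subring of the Grothendieck ring generated by the classes
of the permutation representations `F X` on finite `G`-sets `X`. -/
def burnsideRing (F : Type u) (G : Type v) [Field F] [Group G] :
    Subring (GrothendieckRing F G) :=
  Subring.closure {c | ∃ (X : Type u) (_ : Finite X) (a : G →* Equiv.Perm X),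
    c = repClass (permRep F a)}

end Grothendieck

/-! ### Brauer characters -/

section Brauer

variable {F K : Type*} [Field F] [Field K]

open Classical in
/-- Extension by zero to the algebraic closure of `F` of a homomorphism defined on the roots of
unity (the torsion units) of the algebraic closure. -/
def liftEigenvalue (θ : CommGroup.torsion (AlgebraicClosure F)ˣ →* K) (x : AlgebraicClosure F) :
    K :=
  if h : ∃ u : CommGroup.torsion (AlgebraicClosure F)ˣ,
      ((u : (AlgebraicClosure F)ˣ) : AlgebraicClosure F) = x
  then θ h.choose else 0

/-- The Brauer character of `ρ` with respect to a homomorphism `θ` lifting roots of unity from the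
algebraic closure of `F` to `K`: at `g` it is the sum of the lifts of the eigenvalues of `ρ g`,
counted with algebraic multiplicity. It is meant to be evaluated at `p`-regular `g` (`p` the
characteristic of `F`), whose eigenvalues are roots of unity. -/
def brauerCharacter {G V : Type*} [Group G] [AddCommGroup V] [Module F V] [FiniteDimensional F V]
    (θ : CommGroup.torsion (AlgebraicClosure F)ˣ →* K) (ρ : Representation F G V) (g : G) : K :=
  (((ρ g).charpoly.map (algebraMap F (AlgebraicClosure F))).roots.map (liftEigenvalue θ)).sum

end Brauer

/-! ### Incidence homology of finite projective spaces -/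

/-- The quantum characteristic `m(p, q)`: the least `i > 1` such that
`1 + q + ⋯ + q ^ (i - 1) = 0` in the field with `p` elements. -/
def quantumChar (p q : ℕ) : ℕ :=
  sInf {i : ℕ | 1 < i ∧ ∑ j ∈ Finset.range i, (q : ZMod p) ^ j = 0}

/-- `(k, i)` is a middle index for `n`, with quantum characteristic `m`. -/
def IsMiddleIndex (n m : ℕ) (k : ℤ) (i : ℕ) : Prop :=
  (0 ≤ k ∧ k ≤ n) ∧ (0 < i ∧ i < m) ∧ ((n : ℤ) < 2 * k + m - i ∧ 2 * k + m - i < n + m)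

section Incidence

variable (F 𝔽 : Type u) [Field F] [Field 𝔽] (n : ℕ)

/-- The subspaces of `𝔽 ^ n`, that is, the elements of the projective space `P(n, q)`. -/
abbrev Subsp : Type u := Submodule 𝔽 (Fin n → 𝔽)

/-- The action of `GL(n, 𝔽)` on the subspaces of `𝔽 ^ n`. -/
def subspAction : GL (Fin n) 𝔽 →* Equiv.Perm (Subsp 𝔽 n) where
  toFun g :=
    { toFun := fun x => x.map (Matrix.mulVecLin (g : Matrix (Fin n) (Fin n) 𝔽))
      invFun := fun x => x.map (Matrix.mulVecLin ((g⁻¹ : GL (Fin n) 𝔽) : Matrix (Fin n) (Fin n) 𝔽))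
      left_inv := fun x => by
        change Submodule.map _ (Submodule.map _ x) = x
        rw [← Submodule.map_comp, ← Matrix.mulVecLin_mul, ← Units.val_mul]; simp
      right_inv := fun x => by
        change Submodule.map _ (Submodule.map _ x) = x
        rw [← Submodule.map_comp, ← Matrix.mulVecLin_mul, ← Units.val_mul]; simp }
  map_one' := by ext1 x; simp
  map_mul' g h := by
    ext1 x
    simp [Matrix.mulVecLin_mul, Submodule.map_comp]

/-- The number `π_k(g)` of `k`-dimensional subspaces of `𝔽 ^ n` stabilized by `g`. -/
def fixedCount (k : ℤ) (g : GL (Fin n) 𝔽) : ℕ :=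
  Nat.card {x : Subsp 𝔽 n // (Module.finrank 𝔽 x : ℤ) = k ∧ subspAction 𝔽 n g x = x}

/-- The `F`-vector space `M = ⨁ₖ Mₖ` with basis all subspaces of `𝔽 ^ n`. -/
abbrev TotalModule : Type u := PermModule F (Subsp 𝔽 n)

/-- `Mₖ`, the span of the `k`-dimensional subspaces (zero if `k < 0` or `k > n`). -/
def levelModule (k : ℤ) : Submodule F (TotalModule F 𝔽 n) :=
  Submodule.span F (permBasis F (Subsp 𝔽 n) '' {x | (Module.finrank 𝔽 x : ℤ) = k})

/-- The permutation representation of `GL(n, 𝔽)` on `M`. -/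
abbrev totalRep : Representation F (GL (Fin n) 𝔽) (TotalModule F 𝔽 n) :=
  permRep F (subspAction 𝔽 n)

lemma finrank_subspAction (g : GL (Fin n) 𝔽) (x : Subsp 𝔽 n) :
    Module.finrank 𝔽 (subspAction 𝔽 n g x) = Module.finrank 𝔽 x := by
  refine (LinearEquiv.finrank_eq (Submodule.equivMapOfInjective
    (Matrix.mulVecLin (g : Matrix (Fin n) (Fin n) 𝔽)) ?_ x)).symm
  exact Matrix.mulVec_injective_of_isUnit g.isUnit

lemma subspAction_le_iff (g : GL (Fin n) 𝔽) (x y : Subsp 𝔽 n) :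
    subspAction 𝔽 n g x ≤ subspAction 𝔽 n g y ↔ x ≤ y :=
  Submodule.map_le_map_iff_of_injective (Matrix.mulVec_injective_of_isUnit g.isUnit) x y

lemma levelModule_invariant (k : ℤ) (g : GL (Fin n) 𝔽) :
    levelModule F 𝔽 n k ≤ (levelModule F 𝔽 n k).comap (totalRep F 𝔽 n g) := by
  unfold levelModule
  rw [Submodule.span_le]
  rintro _ ⟨x, hx, rfl⟩
  change totalRep F 𝔽 n g (permBasis F (Subsp 𝔽 n) x) ∈ Submodule.span F _
  rw [permRep_apply_basis]
  refine Submodule.subset_span ⟨_, ?_, rfl⟩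
  simpa [finrank_subspAction] using hx

/-- `Mₖ` as a representation of `GL(n, 𝔽)`. -/
def levelRep (k : ℤ) : Representation F (GL (Fin n) 𝔽) (levelModule F 𝔽 n k) :=
  (totalRep F 𝔽 n).subrepresentation (levelModule F 𝔽 n k) (levelModule_invariant F 𝔽 n k)

variable [Finite 𝔽]

/-- The incidence map `∂`, sending a subspace `x` to the sum of all its subspaces of
codimension one. -/
def incidenceMap : TotalModule F 𝔽 n →ₗ[F] TotalModule F 𝔽 n :=
  (permBasis F (Subsp 𝔽 n)).constr F fun x =>
    ∑ y ∈ (Set.toFinite {y : Subsp 𝔽 n |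
      y ≤ x ∧ Module.finrank 𝔽 y + 1 = Module.finrank 𝔽 x}).toFinset, permBasis F (Subsp 𝔽 n) y

lemma incidenceMap_comm (g : GL (Fin n) 𝔽) (f : TotalModule F 𝔽 n) :
    incidenceMap F 𝔽 n (totalRep F 𝔽 n g f) = totalRep F 𝔽 n g (incidenceMap F 𝔽 n f) := by
  suffices h : (incidenceMap F 𝔽 n).comp (totalRep F 𝔽 n g)
      = (totalRep F 𝔽 n g).comp (incidenceMap F 𝔽 n) from LinearMap.congr_fun h f
  refine (permBasis F (Subsp 𝔽 n)).ext fun x => ?_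
  simp only [LinearMap.comp_apply, permRep_apply_basis, incidenceMap, Module.Basis.constr_basis,
    map_sum]
  symm
  refine Finset.sum_equiv (subspAction 𝔽 n g) (fun y => ?_) (fun y _ => rfl)
  simp [finrank_subspAction, subspAction_le_iff]

lemma incidenceMap_pow_comm (i : ℕ) (g : GL (Fin n) 𝔽) (f : TotalModule F 𝔽 n) :
    (incidenceMap F 𝔽 n ^ i) (totalRep F 𝔽 n g f)
      = totalRep F 𝔽 n g ((incidenceMap F 𝔽 n ^ i) f) := by
  induction i generalizing f with
  | zero => simp
  | succ i ih => simp only [pow_succ, Module.End.mul_apply, incidenceMap_comm, ih]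

/-- `K_{k,i} = ker ∂ⁱ ∩ Mₖ`. -/
def cycles (k : ℤ) (i : ℕ) : Submodule F (TotalModule F 𝔽 n) :=
  LinearMap.ker (incidenceMap F 𝔽 n ^ i) ⊓ levelModule F 𝔽 n k

/-- `I_{k,i} = ∂^{m-i}(M_{k+m-i})`. -/
def boundaries (m : ℕ) (k : ℤ) (i : ℕ) : Submodule F (TotalModule F 𝔽 n) :=
  (levelModule F 𝔽 n (k + m - i)).map (incidenceMap F 𝔽 n ^ (m - i))

lemma cycles_invariant (k : ℤ) (i : ℕ) (g : GL (Fin n) 𝔽) :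
    cycles F 𝔽 n k i ≤ (cycles F 𝔽 n k i).comap (totalRep F 𝔽 n g) := by
  rintro f ⟨hf, hk⟩
  refine ⟨?_, levelModule_invariant F 𝔽 n k g hk⟩
  have hf' : (incidenceMap F 𝔽 n ^ i) f = 0 := hf
  simp [incidenceMap_pow_comm, hf']

lemma boundaries_invariant (m : ℕ) (k : ℤ) (i : ℕ) (g : GL (Fin n) 𝔽) :
    boundaries F 𝔽 n m k i ≤ (boundaries F 𝔽 n m k i).comap (totalRep F 𝔽 n g) := by
  rintro _ ⟨f, hf, rfl⟩
  exact ⟨totalRep F 𝔽 n g f, levelModule_invariant F 𝔽 n _ g hf, incidenceMap_pow_comm F 𝔽 n _ g f⟩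

/-- `K_{k,i}` as a representation of `GL(n, 𝔽)`. -/
def cyclesRep (k : ℤ) (i : ℕ) : Representation F (GL (Fin n) 𝔽) (cycles F 𝔽 n k i) :=
  (totalRep F 𝔽 n).subrepresentation (cycles F 𝔽 n k i) (cycles_invariant F 𝔽 n k i)

/-- The incidence homology `H_{k,i} = K_{k,i} / I_{k,i}` with respect to the parameter `m`. -/
abbrev IncidenceHomology (m : ℕ) (k : ℤ) (i : ℕ) : Type u :=
  cycles F 𝔽 n k i ⧸ (boundaries F 𝔽 n m k i).submoduleOf (cycles F 𝔽 n k i)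

/-- The incidence homology as a representation of `GL(n, 𝔽)`. -/
def homologyRep (m : ℕ) (k : ℤ) (i : ℕ) :
    Representation F (GL (Fin n) 𝔽) (IncidenceHomology F 𝔽 n m k i) :=
  (cyclesRep F 𝔽 n k i).quotient ((boundaries F 𝔽 n m k i).submoduleOf (cycles F 𝔽 n k i))
    fun g _ hf => boundaries_invariant F 𝔽 n m k i g hf

end Incidence

end

/-! Everything rests on one vanishing statement, `exactOffMiddle_of_charP`: ∂^m = 0, and ker ∂^i ∩
M_k = ∂^{m-i}(M_{k+m-i}) whenever (k, i) is off the middle.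

Granted this, the formulas are a Hopf trace argument. The maps ∂^i : M_{k+tm} → M_{k-i+tm} and
∂^{m-i} : M_{k-i+tm} → M_{k+(t-1)m} form a bounded complex whose homology groups are H_{k+tm,i} and
H_{k-i+tm,m-i}. Only (k, i) itself is a middle index among these positions, so for every invariant
additive on short exact sequences the alternating sum over the terms is the value at H_{k,i}
(`IsAdditiveInvariant.homologyRep_eq`). The class in the Grothendieck ring and the Brauer character
at g are both additive. On a permutation module a p-regular g has characteristic polynomial ∏ (X^l -
1) over its cycle lengths l, and the lifted roots of X^l - 1 sum to 0 unless l = 1, so the Brauer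
character counts fixed points.

Vanishing is proved by induction on the dimension, with ∂ viewed as the operator D = `coverSum` on
functions on the subspaces of V = W × 𝔽. The group W acts on V by (w, t) ↦ (w + tu, t), fixing the
hyperplane W × 0 pointwise. Since char F ≠ char 𝔽, after adjoining roots of unity the functions on
subspaces outside the hyperplane split along the characters ψ ∘ l of W, l in the dual of W
(`fourier_inversion`). For l ≠ 0 the component is a copy of the complex of ker l; the dimension is
lower by 2 and degrees are shifted by 1, so the middle is preserved. For l = 0 the component,
together with the functions supported in the hyperplane, is the twisted double of the complex of W,
with operator (b, a) ↦ (qDb, Da + b). The corner entry of its i-th power is [i]_q D^{i-1} with [i]_q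
= 1 + ⋯ + q^{i-1}. This is where m enters: [m]_q = 0 makes the m-th power vanish, and [i]_q ≠ 0 for
0 < i < m lets a diagram chase transfer exactness (`ExactOffMiddle.twistedDouble`). A linear
retraction brings the result back from the extension field to F (`exactOffMiddle_descend`). -/

noncomputable section

/-! ### The incidence map on functions on the lattice of subspaces -/

section CoverSum

set_option linter.unusedSectionVars false

attribute [local instance] Fintype.ofFinite

open Module

variable {𝔽 : Type*} [Field 𝔽] {E : Type*} [Field E]

/-- `x` contains `y` with codimension one. -/
def IsCover {V : Type*} [AddCommGroup V] [Module 𝔽 V] (y x : Submodule 𝔽 V) : Prop :=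
  y ≤ x ∧ finrank 𝔽 y + 1 = finrank 𝔽 x

open Classical in
/-- The incidence map on functions: the value at `y` is the sum of the values at all `x`
containing `y` with codimension one. -/
def coverSum (𝔽 E : Type*) [Field 𝔽] [Field E] (V : Type*) [AddCommGroup V]
    [Module 𝔽 V] [Finite V] : (Submodule 𝔽 V → E) →ₗ[E] (Submodule 𝔽 V → E) where
  toFun f y := ∑ x : Submodule 𝔽 V with IsCover y x, f x
  map_add' f g := by ext y; simp [Finset.sum_add_distrib]
  map_smul' c f := by ext y; simp [Finset.mul_sum]

/-- Functions supported on the subspaces of dimension `k`. -/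
def gradedPart (𝔽 E : Type*) [Field 𝔽] [Field E] (V : Type*) [AddCommGroup V]
    [Module 𝔽 V] (k : ℤ) : Submodule E (Submodule 𝔽 V → E) where
  carrier := {f | ∀ x : Submodule 𝔽 V, (finrank 𝔽 x : ℤ) ≠ k → f x = 0}
  add_mem' hf hg x hx := by simp [hf x hx, hg x hx]
  zero_mem' x _ := rfl
  smul_mem' c f hf x hx := by simp [hf x hx]

section Basic

variable {V : Type*} [AddCommGroup V] [Module 𝔽 V] [Finite V]

open Classical in
lemma coverSum_apply (f : Submodule 𝔽 V → E) (y : Submodule 𝔽 V) :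
    coverSum 𝔽 E V f y = ∑ x : Submodule 𝔽 V with IsCover y x, f x := rfl

lemma mem_gradedPart {k : ℤ} {f : Submodule 𝔽 V → E} :
    f ∈ gradedPart 𝔽 E V k ↔ ∀ x : Submodule 𝔽 V, (finrank 𝔽 x : ℤ) ≠ k → f x = 0 := Iff.rfl

/-- Multiplication of a function by `c ^ dim`. -/
def dimWeight (𝔽 : Type*) [Field 𝔽] {V : Type*} [AddCommGroup V] [Module 𝔽 V] (c : E)
    (f : Submodule 𝔽 V → E) : Submodule 𝔽 V → E :=
  fun x => c ^ finrank 𝔽 x * f x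

/-- A cover raises the dimension by exactly one, so conjugating by c ^ dim only rescales the
operator. This supplies the factor q in the twisted double. -/
lemma coverSum_dimWeight (c : E) (f : Submodule 𝔽 V → E) :
    coverSum 𝔽 E V (dimWeight 𝔽 c f) = c • dimWeight 𝔽 c (coverSum 𝔽 E V f) := by
  classical
  ext y
  simp only [coverSum_apply, dimWeight, Pi.smul_apply, smul_eq_mul, Finset.mul_sum]
  refine Finset.sum_congr rfl fun x hx => ?_
  rw [← (Finset.mem_filter.1 hx).2.2]
  ring

end Basic

/-! ### Extension and restriction along an injective linear map -/

section Extend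

variable {U V : Type*} [AddCommGroup U] [Module 𝔽 U] [Finite U]
  [AddCommGroup V] [Module 𝔽 V] [Finite V]

open Classical in
/-- Extension by zero along an injective linear map. -/
def extendZero (j : U →ₗ[𝔽] V) (g : Submodule 𝔽 U → E) : Submodule 𝔽 V → E :=
  fun x => if x ≤ LinearMap.range j then g (x.comap j) else 0

/-- Restriction of a function on subspaces along a linear map. -/
def restrictMap (j : U →ₗ[𝔽] V) (f : Submodule 𝔽 V → E) : Submodule 𝔽 U → E :=
  fun y => f (y.map j)

variable {j : U →ₗ[𝔽] V}

lemma finrank_map_of_injective (hj : Function.Injective j) (y : Submodule 𝔽 U) :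
    finrank 𝔽 (y.map j) = finrank 𝔽 y :=
  (LinearEquiv.finrank_eq (Submodule.equivMapOfInjective j hj y)).symm

lemma finrank_comap_of_le_range (hj : Function.Injective j) {x : Submodule 𝔽 V}
    (hx : x ≤ LinearMap.range j) : finrank 𝔽 (x.comap j) = finrank 𝔽 x := by
  rw [← finrank_map_of_injective hj, Submodule.map_comap_eq_self hx]

lemma isCover_map_iff (hj : Function.Injective j) (y x : Submodule 𝔽 U) :
    IsCover (y.map j) (x.map j) ↔ IsCover y x := by
  simp only [IsCover, finrank_map_of_injective hj, Submodule.map_le_map_iff_of_injective hj]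

open Classical in
lemma sum_isCover_map_of_le_range (hj : Function.Injective j) (y : Submodule 𝔽 U)
    (f : Submodule 𝔽 V → E) :
    ∑ x : Submodule 𝔽 V with IsCover (y.map j) x ∧ x ≤ LinearMap.range j, f x
      = ∑ x : Submodule 𝔽 U with IsCover y x, f (x.map j) := by
  symm
  refine Finset.sum_nbij' (fun x => x.map j) (fun x => x.comap j) ?_ ?_ ?_ ?_ ?_
  · intro x hx
    simpa [isCover_map_iff hj, LinearMap.map_le_range] using hx
  · intro x hx
    simp only [Finset.mem_filter, Finset.mem_univ, true_and] at hx ⊢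
    rw [← isCover_map_iff hj, Submodule.map_comap_eq_self hx.2]
    exact hx.1
  · intro x _
    exact Submodule.comap_map_eq_of_injective hj x
  · intro x hx
    simp only [Finset.mem_filter, Finset.mem_univ, true_and] at hx
    exact Submodule.map_comap_eq_self hx.2
  · intro x _
    rfl

/-- If some cover of z lies in the range, so does z; hence functions supported inside the range form
a subcomplex. -/
lemma coverSum_extendZero (hj : Function.Injective j) (g : Submodule 𝔽 U → E) :
    coverSum 𝔽 E V (extendZero j g) = extendZero j (coverSum 𝔽 E U g) := by
  classical
  ext z
  by_cases hz : z ≤ LinearMap.range j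
  · obtain ⟨y, rfl⟩ : ∃ y : Submodule 𝔽 U, y.map j = z := ⟨_, Submodule.map_comap_eq_self hz⟩
    simp only [extendZero, hz, if_true, coverSum_apply, ← Finset.sum_filter,
      Finset.filter_filter]
    rw [sum_isCover_map_of_le_range hj y (fun x => g (x.comap j))]
    simp only [Submodule.comap_map_eq_of_injective hj]
  · simp only [extendZero, hz, if_false, coverSum_apply]
    refine Finset.sum_eq_zero fun x hx => if_neg fun h => hz ?_
    exact (Finset.mem_filter.1 hx).2.1.trans h

open Classical in
-- Restriction fails to commute with the operator exactly by the covers that leave the range. For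
-- the hyperplane this error is the coupling term b in the twisted double; elsewhere it vanishes.
lemma restrictMap_coverSum (hj : Function.Injective j) (f : Submodule 𝔽 V → E)
    (y : Submodule 𝔽 U) :
    restrictMap j (coverSum 𝔽 E V f) y = coverSum 𝔽 E U (restrictMap j f) y
      + ∑ x : Submodule 𝔽 V with IsCover (y.map j) x ∧ ¬ x ≤ LinearMap.range j, f x := by
  simp only [restrictMap, coverSum_apply]
  rw [← sum_isCover_map_of_le_range hj y f, ← Finset.filter_filter, ← Finset.filter_filter,
    Finset.sum_filter_add_sum_filter_not]

lemma extendZero_mem_gradedPart (hj : Function.Injective j) {k : ℤ} {g : Submodule 𝔽 U → E}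
    (hg : g ∈ gradedPart 𝔽 E U k) : extendZero j g ∈ gradedPart 𝔽 E V k := by
  intro x hx
  by_cases h : x ≤ LinearMap.range j
  · rw [extendZero, if_pos h]
    exact hg _ (by rwa [finrank_comap_of_le_range hj h])
  · exact if_neg h

lemma restrictMap_mem_gradedPart (hj : Function.Injective j) {k : ℤ} {f : Submodule 𝔽 V → E}
    (hf : f ∈ gradedPart 𝔽 E V k) : restrictMap j f ∈ gradedPart 𝔽 E U k :=
  fun x hx => hf _ (by rwa [finrank_map_of_injective hj])

lemma extendZero_restrictMap {f : Submodule 𝔽 V → E}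
    (hf : ∀ x : Submodule 𝔽 V, ¬ x ≤ LinearMap.range j → f x = 0) : extendZero j (restrictMap j f) = f := by
  ext x
  by_cases h : x ≤ LinearMap.range j
  · rw [extendZero, if_pos h, restrictMap, Submodule.map_comap_eq_self h]
  · rw [extendZero, if_neg h, hf x h]

end Extend

end CoverSum

/-! ### Subspaces of `W × 𝔽` relative to the hyperplane `W × 0` -/

section Hyperplane

set_option linter.unusedSectionVars false

attribute [local instance] Fintype.ofFinite

open Module

variable {𝔽 : Type*} [Field 𝔽] {E : Type*} [Field E]
  {W : Type*} [AddCommGroup W] [Module 𝔽 W]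

/-- The trace of a subspace of `W × 𝔽` on the hyperplane `W × 0`. -/
def hypTrace (x : Submodule 𝔽 (W × 𝔽)) : Submodule 𝔽 W := x.comap (LinearMap.inl 𝔽 W 𝔽)

/-- The subspace spanned by `y × 0` and `(v, 1)`. -/
def coneOver (y : Submodule 𝔽 W) (v : W) : Submodule 𝔽 (W × 𝔽) :=
  y.comap (LinearMap.fst 𝔽 W 𝔽 - (LinearMap.snd 𝔽 W 𝔽).smulRight v)

lemma mem_hypTrace {x : Submodule 𝔽 (W × 𝔽)} {w : W} : w ∈ hypTrace x ↔ (w, (0 : 𝔽)) ∈ x :=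
  Iff.rfl

lemma mem_coneOver {y : Submodule 𝔽 W} {v w : W} {t : 𝔽} :
    (w, t) ∈ coneOver y v ↔ w - t • v ∈ y := Iff.rfl

lemma hypTrace_mono {x x' : Submodule 𝔽 (W × 𝔽)} (h : x ≤ x') : hypTrace x ≤ hypTrace x' :=
  Submodule.comap_mono h

lemma hypTrace_coneOver (y : Submodule 𝔽 W) (v : W) : hypTrace (coneOver y v) = y := by
  ext w
  simp [mem_hypTrace, mem_coneOver]

lemma mem_range_inl {a : W × 𝔽} : a ∈ LinearMap.range (LinearMap.inl 𝔽 W 𝔽) ↔ a.2 = 0 := by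
  rcases a with ⟨w, t⟩
  simp [eq_comm]

lemma not_mem_of_le_range_inl {x : Submodule 𝔽 (W × 𝔽)}
    (hx : x ≤ LinearMap.range (LinearMap.inl 𝔽 W 𝔽)) (v : W) : (v, (1 : 𝔽)) ∉ x := fun h => by
  simpa using mem_range_inl.1 (hx h)

lemma exists_mem_of_not_le_range_inl {x : Submodule 𝔽 (W × 𝔽)}
    (hx : ¬ x ≤ LinearMap.range (LinearMap.inl 𝔽 W 𝔽)) : ∃ v, (v, (1 : 𝔽)) ∈ x := by
  obtain ⟨⟨w, t⟩, hw, ht⟩ := SetLike.not_le_iff_exists.1 hx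
  rw [mem_range_inl] at ht
  refine ⟨t⁻¹ • w, ?_⟩
  simpa [inv_mul_cancel₀ ht] using x.smul_mem t⁻¹ hw

lemma coneOver_le {x : Submodule 𝔽 (W × 𝔽)} {v : W} (hv : (v, (1 : 𝔽)) ∈ x) {y : Submodule 𝔽 W}
    (hy : y ≤ hypTrace x) : coneOver y v ≤ x := by
  rintro ⟨w, t⟩ h
  have h1 := x.add_mem (mem_hypTrace.1 (hy (mem_coneOver.1 h))) (x.smul_mem t hv)
  simpa using h1

lemma coneOver_hypTrace {x : Submodule 𝔽 (W × 𝔽)} {v : W} (hv : (v, (1 : 𝔽)) ∈ x) :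
    coneOver (hypTrace x) v = x := by
  refine le_antisymm (coneOver_le hv le_rfl) ?_
  rintro ⟨w, t⟩ h
  rw [mem_coneOver, mem_hypTrace]
  simpa using x.sub_mem h (x.smul_mem t hv)

variable [Finite W] [Finite 𝔽]

lemma finrank_eq_hypTrace_add_one {x : Submodule 𝔽 (W × 𝔽)} {v : W} (hv : (v, (1 : 𝔽)) ∈ x) :
    finrank 𝔽 x = finrank 𝔽 (hypTrace x) + 1 := by
  have h := ((LinearMap.snd 𝔽 W 𝔽).domRestrict x).finrank_range_add_finrank_ker
  have hr : LinearMap.range ((LinearMap.snd 𝔽 W 𝔽).domRestrict x) = ⊤ := by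
    refine LinearMap.range_eq_top.2 fun t => ⟨⟨_, x.smul_mem t hv⟩, ?_⟩
    simp
  have hk : finrank 𝔽 (LinearMap.ker ((LinearMap.snd 𝔽 W 𝔽).domRestrict x))
      = finrank 𝔽 (hypTrace x) := by
    refine LinearEquiv.finrank_eq
      { toFun := fun a => ⟨a.1.1.1, ?_⟩
        map_add' := fun a b => rfl
        map_smul' := fun c a => rfl
        invFun := fun w => ⟨⟨(w.1, 0), w.2⟩, rfl⟩
        left_inv := ?_
        right_inv := fun w => rfl }
    · obtain ⟨⟨⟨w, t⟩, hx⟩, ht⟩ := a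
      obtain rfl : t = 0 := ht
      exact hx
    · rintro ⟨⟨⟨w, t⟩, hx⟩, ht⟩
      obtain rfl : t = 0 := ht
      rfl
  rw [hr, finrank_top, finrank_self, hk] at h
  omega

lemma finrank_coneOver (y : Submodule 𝔽 W) (v : W) :
    finrank 𝔽 (coneOver y v) = finrank 𝔽 y + 1 := by
  rw [finrank_eq_hypTrace_add_one (v := v) (by simp [mem_coneOver]), hypTrace_coneOver]

open Classical in
/-- Covers of a subspace not in the hyperplane correspond to covers of its trace. -/
lemma sum_isCover_of_mem {z : Submodule 𝔽 (W × 𝔽)} {v : W} (hv : (v, (1 : 𝔽)) ∈ z)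
    {f : Submodule 𝔽 (W × 𝔽) → E} {g : Submodule 𝔽 W → E}
    (hfg : ∀ x, IsCover z x → f x = g (hypTrace x)) :
    ∑ x : Submodule 𝔽 (W × 𝔽) with IsCover z x, f x
      = ∑ y : Submodule 𝔽 W with IsCover (hypTrace z) y, g y := by
  refine Finset.sum_nbij' hypTrace (fun y => coneOver y v) ?_ ?_ ?_ ?_ ?_
  · intro x hx
    simp only [Finset.mem_filter, Finset.mem_univ, true_and] at hx ⊢
    refine ⟨hypTrace_mono hx.1, ?_⟩
    have h1 := finrank_eq_hypTrace_add_one hv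
    have h2 := finrank_eq_hypTrace_add_one (hx.1 hv)
    have h3 := hx.2
    omega
  · intro y hy
    simp only [Finset.mem_filter, Finset.mem_univ, true_and] at hy ⊢
    refine ⟨?_, ?_⟩
    · rw [← coneOver_hypTrace hv]
      exact Submodule.comap_mono hy.1
    · rw [finrank_coneOver, finrank_eq_hypTrace_add_one hv, hy.2]
  · intro x hx
    exact coneOver_hypTrace ((Finset.mem_filter.1 hx).2.1 hv)
  · intro y _
    exact hypTrace_coneOver y v
  · intro x hx
    exact hfg x (Finset.mem_filter.1 hx).2

/-- The covers of a subspace of the hyperplane that lie outside the hyperplane. -/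
lemma isCover_map_inl_iff {y : Submodule 𝔽 W} {x : Submodule 𝔽 (W × 𝔽)}
    (hx : ¬ x ≤ LinearMap.range (LinearMap.inl 𝔽 W 𝔽)) :
    IsCover (y.map (LinearMap.inl 𝔽 W 𝔽)) x ↔ hypTrace x = y := by
  obtain ⟨v, hv⟩ := exists_mem_of_not_le_range_inl hx
  rw [IsCover, finrank_map_of_injective LinearMap.inl_injective, finrank_eq_hypTrace_add_one hv,
    Submodule.map_le_iff_le_comap]
  change y ≤ hypTrace x ∧ _ ↔ _
  constructor
  · rintro ⟨h1, h2⟩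
    exact (Submodule.eq_of_le_of_finrank_eq h1 (by omega)).symm
  · rintro rfl
    exact ⟨le_rfl, rfl⟩

/-! ### Sums over the affine part of a subspace -/

open Classical in
/-- The sum of `h` over the affine part `{v | (v, 1) ∈ x}` of `x`. -/
def affineSum (h : W → E) (x : Submodule 𝔽 (W × 𝔽)) : E := ∑ v : W with (v, (1 : 𝔽)) ∈ x, h v

lemma affineSum_of_le {x : Submodule 𝔽 (W × 𝔽)}
    (hx : x ≤ LinearMap.range (LinearMap.inl 𝔽 W 𝔽)) (h : W → E) : affineSum h x = 0 :=
  Finset.sum_eq_zero fun v hv => by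
    classical
    exact absurd (Finset.mem_filter.1 hv).2 (not_mem_of_le_range_inl hx v)

open Classical in
lemma affineSum_eq_sum_translate {x : Submodule 𝔽 (W × 𝔽)} {v : W} (hv : (v, (1 : 𝔽)) ∈ x)
    (h : W → E) : affineSum h x = ∑ u with u ∈ hypTrace x, h (v + u) := by
  refine Finset.sum_nbij' (fun w => w - v) (fun u => v + u) ?_ ?_ ?_ ?_ ?_
  · intro w hw
    simp only [Finset.mem_filter, Finset.mem_univ, true_and] at hw ⊢
    rw [mem_hypTrace]
    simpa using x.sub_mem hw hv
  · intro u hu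
    simp only [Finset.mem_filter, Finset.mem_univ, true_and] at hu ⊢
    simpa using x.add_mem hv (mem_hypTrace.1 hu)
  · intro w _
    simp
  · intro u _
    simp
  · intro w _
    simp

open Classical in
/-- Each `(v, 1) ∈ x` lies in exactly one subspace of `x` with given trace `y`. -/
lemma sum_affineSum_of_le {x : Submodule 𝔽 (W × 𝔽)} {y : Submodule 𝔽 W} (hy : y ≤ hypTrace x)
    (h : W → E) :
    ∑ x' : Submodule 𝔽 (W × 𝔽) with x' ≤ x ∧ hypTrace x' = y, affineSum h x' = affineSum h x := by
  unfold affineSum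
  rw [Finset.sum_comm' (t' := Finset.univ.filter fun v : W => (v, (1 : 𝔽)) ∈ x)
    (s' := fun v => {coneOver y v})]
  · simp
  · intro x' v
    simp only [Finset.mem_filter, Finset.mem_univ, true_and, Finset.mem_singleton]
    constructor
    · rintro ⟨⟨h1, rfl⟩, h3⟩
      exact ⟨(coneOver_hypTrace h3).symm, h1 h3⟩
    · rintro ⟨rfl, h2⟩
      exact ⟨⟨coneOver_le h2 hy, hypTrace_coneOver y v⟩, by simp [mem_coneOver]⟩

open Classical in
lemma sum_affineSum (y : Submodule 𝔽 W) (h : W → E) :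
    ∑ x : Submodule 𝔽 (W × 𝔽) with hypTrace x = y, affineSum h x = ∑ v, h v := by
  have h1 := sum_affineSum_of_le (x := ⊤) (y := y) (fun w _ => Submodule.mem_top) h
  simpa [affineSum] using h1

/-- The cardinality of the field as an element of `E`. -/
def fieldCard (𝔽 E : Type*) [Field E] : E := (Nat.card 𝔽 : E)

open Classical in
lemma sum_one_submodule (y : Submodule 𝔽 W) :
    ∑ u with u ∈ y, (1 : E) = fieldCard 𝔽 E ^ finrank 𝔽 y := by
  have h : Fintype.card {u // u ∈ y} = Nat.card y := Nat.card_eq_fintype_card.symm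
  rw [Finset.sum_const, nsmul_one, ← Fintype.card_subtype, h, Module.natCard_eq_pow_finrank (K := 𝔽),
    fieldCard, Nat.cast_pow]

lemma affineSum_one {x : Submodule 𝔽 (W × 𝔽)}
    (hx : ¬ x ≤ LinearMap.range (LinearMap.inl 𝔽 W 𝔽)) :
    affineSum (fun _ => (1 : E)) x = fieldCard 𝔽 E ^ finrank 𝔽 (hypTrace x) := by
  obtain ⟨v, hv⟩ := exists_mem_of_not_le_range_inl hx
  rw [affineSum_eq_sum_translate hv, sum_one_submodule]

lemma sum_one_space : ∑ _v : W, (1 : E) = fieldCard 𝔽 E ^ finrank 𝔽 W := by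
  have h := sum_one_submodule (E := E) (⊤ : Submodule 𝔽 W)
  simpa using h

/-! ### Fourier components -/

open Classical in
/-- `fourierDown h f y = Σ f(x) h(v)`, over the `x` with trace `y` and the `v` with
`(v, 1) ∈ x`. -/
def fourierDown (h : W → E) (f : Submodule 𝔽 (W × 𝔽) → E) : Submodule 𝔽 W → E :=
  fun y => ∑ x : Submodule 𝔽 (W × 𝔽) with hypTrace x = y, affineSum h x * f x

/-- The normalized lift of a function on subspaces of `W` to subspaces of `W × 𝔽`, with
coefficients given by `h`. -/
def fourierUp (h : W → E) (g : Submodule 𝔽 W → E) : Submodule 𝔽 (W × 𝔽) → E :=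
  fun x => affineSum h x * ((fieldCard 𝔽 E)⁻¹ ^ finrank 𝔽 (hypTrace x) * g (hypTrace x))
    * (fieldCard 𝔽 E)⁻¹ ^ finrank 𝔽 W

/-- No condition on h is needed. The coefficients of f x agree: if the trace of x covers y, each
affine point of x lies in exactly one subspace of x with trace y, and otherwise both coefficients
vanish. -/
lemma fourierDown_coverSum (h : W → E) (f : Submodule 𝔽 (W × 𝔽) → E) :
    fourierDown h (coverSum 𝔽 E _ f) = coverSum 𝔽 E _ (fourierDown h f) := by
  classical
  ext y
  simp only [fourierDown, coverSum_apply, Finset.mul_sum]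
  rw [Finset.sum_comm' (t' := Finset.univ)
    (s' := fun x => Finset.univ.filter fun x' => hypTrace x' = y ∧ IsCover x' x) (by simp)]
  rw [Finset.sum_comm' (t' := Finset.univ)
    (s' := fun x => Finset.univ.filter fun y' => IsCover y y' ∧ hypTrace x = y') (by simp)]
  refine Finset.sum_congr rfl fun x _ => ?_
  by_cases hx : x ≤ LinearMap.range (LinearMap.inl 𝔽 W 𝔽)
  · rw [Finset.sum_eq_zero, Finset.sum_eq_zero]
    · intro y' _
      rw [affineSum_of_le hx, zero_mul]
    · intro x' hx'
      rw [affineSum_of_le ((Finset.mem_filter.1 hx').2.2.1.trans hx), zero_mul]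
  obtain ⟨v, hv⟩ := exists_mem_of_not_le_range_inl hx
  rw [← Finset.sum_mul, ← Finset.sum_mul]
  congr 1
  by_cases hy : IsCover y (hypTrace x)
  · have h2 : (Finset.univ.filter fun y' => IsCover y y' ∧ hypTrace x = y') = {hypTrace x} := by
      ext y'
      simp only [Finset.mem_filter, Finset.mem_univ, true_and, Finset.mem_singleton]
      exact ⟨fun h => h.2.symm, by rintro rfl; exact ⟨hy, rfl⟩⟩
    rw [h2, Finset.sum_singleton, ← sum_affineSum_of_le hy.1]
    refine Finset.sum_subset_zero_on_sdiff ?_ ?_ fun _ _ => rfl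
    · intro x' hx'
      simp only [Finset.mem_filter, Finset.mem_univ, true_and] at hx' ⊢
      exact ⟨hx'.2.1, hx'.1⟩
    · intro x' hx'
      simp only [Finset.mem_sdiff, Finset.mem_filter, Finset.mem_univ, true_and] at hx'
      refine affineSum_of_le ?_ h
      by_contra hc
      obtain ⟨v', hv'⟩ := exists_mem_of_not_le_range_inl hc
      refine hx'.2 ⟨hx'.1.2, hx'.1.1, ?_⟩
      rw [finrank_eq_hypTrace_add_one hv', finrank_eq_hypTrace_add_one hv, hx'.1.2, hy.2]
  · rw [Finset.sum_eq_zero, Finset.sum_eq_zero]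
    · intro y' hy'
      obtain ⟨h1, rfl⟩ := (Finset.mem_filter.1 hy').2
      exact absurd h1 hy
    · intro x' hx'
      obtain ⟨rfl, h1, h2⟩ := (Finset.mem_filter.1 hx').2
      refine affineSum_of_le ?_ h
      by_contra hc
      obtain ⟨v', hv'⟩ := exists_mem_of_not_le_range_inl hc
      refine hy ⟨hypTrace_mono h1, ?_⟩
      rw [finrank_eq_hypTrace_add_one hv', finrank_eq_hypTrace_add_one hv] at h2
      omega

/-- `h` and `g` are compatible if `h` is invariant under translation by any subspace on which `g`
does not vanish. -/
def TranslationCompatible (h : W → E) (g : Submodule 𝔽 W → E) : Prop :=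
  ∀ y, g y ≠ 0 → ∀ u ∈ y, ∀ v, h (v + u) = h v

lemma affineSum_of_invariant {h : W → E} {x : Submodule 𝔽 (W × 𝔽)} {v : W}
    (hv : (v, (1 : 𝔽)) ∈ x) (hx : ∀ u ∈ hypTrace x, ∀ v, h (v + u) = h v) :
    affineSum h x = fieldCard 𝔽 E ^ finrank 𝔽 (hypTrace x) * h v := by
  classical
  rw [affineSum_eq_sum_translate hv, ← sum_one_submodule, Finset.sum_mul]
  refine Finset.sum_congr rfl fun u hu => ?_
  rw [hx u (Finset.mem_filter.1 hu).2, one_mul]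

/-- Outside the hyperplane the lift commutes with the operator. On a subspace y of the hyperplane,
the covers outside have trace y and their affine parts partition W, which produces the total sum of
h. So the correction vanishes for nontrivial characters and survives for h = 1. -/
lemma coverSum_fourierUp (hq : fieldCard 𝔽 E ≠ 0) {h : W → E} {g : Submodule 𝔽 W → E}
    (hg : TranslationCompatible h g) :
    coverSum 𝔽 E _ (fourierUp h g) = fourierUp h (coverSum 𝔽 E _ g)
      + ((∑ v, h v) * (fieldCard 𝔽 E)⁻¹ ^ finrank 𝔽 W) •
        extendZero (LinearMap.inl 𝔽 W 𝔽) (dimWeight 𝔽 (fieldCard 𝔽 E)⁻¹ g) := by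
  classical
  -- Invariance makes the affine sum equal to q ^ dim times h v, and the normalization cancels that
  -- power. Covers of z all contain the same point (v, 1), so h v factors out.
  have key : ∀ {x : Submodule 𝔽 (W × 𝔽)} {v : W}, (v, (1 : 𝔽)) ∈ x →
      fourierUp h g x = h v * g (hypTrace x) * (fieldCard 𝔽 E)⁻¹ ^ finrank 𝔽 W := by
    intro x v hv
    by_cases h0 : g (hypTrace x) = 0
    · simp [fourierUp, h0]
    · have h1 : fieldCard 𝔽 E ^ finrank 𝔽 (hypTrace x) ≠ 0 := pow_ne_zero _ hq
      rw [fourierUp, affineSum_of_invariant hv (hg _ h0), inv_pow, inv_pow]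
      field_simp
  ext z
  simp only [Pi.add_apply, Pi.smul_apply, smul_eq_mul]
  by_cases hz : z ≤ LinearMap.range (LinearMap.inl 𝔽 W 𝔽)
  · obtain ⟨y, rfl⟩ : ∃ y : Submodule 𝔽 W, y.map (LinearMap.inl 𝔽 W 𝔽) = z :=
      ⟨_, Submodule.map_comap_eq_self hz⟩
    rw [fourierUp, affineSum_of_le hz, zero_mul, zero_mul, zero_add, extendZero, if_pos hz,
      Submodule.comap_map_eq_of_injective LinearMap.inl_injective, coverSum_apply,
      ← sum_affineSum y h, dimWeight, Finset.sum_mul, Finset.sum_mul]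
    rw [Finset.sum_filter, Finset.sum_filter]
    refine Finset.sum_congr rfl fun x _ => ?_
    by_cases hx : x ≤ LinearMap.range (LinearMap.inl 𝔽 W 𝔽)
    · rw [fourierUp, affineSum_of_le hx, zero_mul, zero_mul, ite_self, zero_mul, ite_self]
    · rw [isCover_map_inl_iff hx]
      split_ifs with hxy
      · rw [fourierUp, hxy]
        ring
      · rfl
  · obtain ⟨v, hv⟩ := exists_mem_of_not_le_range_inl hz
    rw [extendZero, if_neg hz, mul_zero, add_zero, coverSum_apply,
      sum_isCover_of_mem hv (g := fun y => h v * g y * (fieldCard 𝔽 E)⁻¹ ^ finrank 𝔽 W)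
        (fun x hx => key (hx.1 hv)), ← Finset.sum_mul, ← Finset.mul_sum, ← coverSum_apply]
    by_cases h0 : coverSum 𝔽 E W g (hypTrace z) = 0
    · simp [fourierUp, h0]
    · obtain ⟨y, hy, hy0⟩ := Finset.exists_ne_zero_of_sum_ne_zero h0
      have h1 : fieldCard 𝔽 E ^ finrank 𝔽 (hypTrace z) ≠ 0 := pow_ne_zero _ hq
      rw [fourierUp, affineSum_of_invariant hv
        (fun u hu => hg _ hy0 u ((Finset.mem_filter.1 hy).2.1 hu)), inv_pow, inv_pow]
      field_simp

end Hyperplane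

/-! ### Exactness away from the middle for graded nilpotent operators -/

section Nilpotent

variable {E N N' : Type*} [Field E] [AddCommGroup N] [Module E N] [AddCommGroup N'] [Module E N']

/-- The position `(k, i)` is not a middle index. -/
def OffMiddle (m n : ℕ) (k : ℤ) (i : ℕ) : Prop :=
  2 * k + m - i ≤ n ∨ (n : ℤ) + m ≤ 2 * k + m - i

/-- `D ^ m = 0`, and all homology at positions that are not middle indices vanishes. -/
def ExactOffMiddle (m n : ℕ) (D : Module.End E N) (L : ℤ → Submodule E N) : Prop :=
  D ^ m = 0 ∧ ∀ (k : ℤ) (i : ℕ), i ≤ m → OffMiddle m n k i → ∀ v ∈ L k, (D ^ i) v = 0 →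
    ∃ u ∈ L (k + m - i), (D ^ (m - i)) u = v

/-- The component `P v` of every cycle `v` away from the middle is a boundary. -/
def ExactComponent (m n : ℕ) (D : Module.End E N) (L : ℤ → Submodule E N) (P : N → N) : Prop :=
  (∀ v, (D ^ m) (P v) = 0) ∧ ∀ (k : ℤ) (i : ℕ), i ≤ m → OffMiddle m n k i → ∀ v ∈ L k,
    (D ^ i) v = 0 → ∃ u ∈ L (k + m - i), (D ^ (m - i)) u = P v

lemma pow_comm_of_comm {E' M : Type*} [Field E'] [AddCommGroup M] [Module E' M]
    {D : Module.End E N} {D' : Module.End E' M} {r : N → M}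
    (hr : ∀ v, r (D v) = D' (r v)) (i : ℕ) (v : N) : r ((D ^ i) v) = (D' ^ i) (r v) := by
  induction i generalizing v with
  | zero => simp
  | succ i ih => rw [pow_succ, pow_succ, Module.End.mul_apply, Module.End.mul_apply, ih, hr]

/-- A cycle is sent across by r, solved there, and brought back by ι. Shifting k by s while n drops
by 2s leaves the off-middle condition unchanged. Only compatibility with the operators and the
gradings is used: ι ∘ r is the component, not the identity. -/
lemma ExactComponent.of_retract {m n n' : ℕ} {D : Module.End E N} {D' : Module.End E N'}
    {L : ℤ → Submodule E N} {L' : ℤ → Submodule E N'} (h : ExactOffMiddle m n' D' L') (s : ℕ)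
    (hn : n = n' + 2 * s) {r : N → N'} {ι : N' → N} (hr0 : r 0 = 0) (hι0 : ι 0 = 0)
    (hr : ∀ v, r (D v) = D' (r v)) (hι : ∀ v, ι (D' v) = D (ι v))
    (hrL : ∀ k, ∀ v ∈ L k, r v ∈ L' (k - s)) (hιL : ∀ k, ∀ v ∈ L' (k - s), ι v ∈ L k) :
    ExactComponent m n D L (fun v => ι (r v)) := by
  refine ⟨fun v => ?_, fun k i hi hk v hv hv0 => ?_⟩
  · rw [← pow_comm_of_comm hι, h.1, LinearMap.zero_apply, hι0]
  · obtain ⟨u, hu, huv⟩ := h.2 (k - s) i hi (by unfold OffMiddle at *; omega) (r v) (hrL k v hv)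
      (by rw [← pow_comm_of_comm hr, hv0, hr0])
    refine ⟨ι u, hιL _ u ?_, ?_⟩
    · rwa [show k + m - i - s = k - s + m - i by ring]
    · rw [← pow_comm_of_comm hι, huv]

lemma ExactOffMiddle.of_components {m n : ℕ} {D : Module.End E N} {L : ℤ → Submodule E N}
    {S : Type*} (s : Finset S) {P : N → N} {Q : S → N → N} (hP : ExactComponent m n D L P)
    (hQ : ∀ a ∈ s, ExactComponent m n D L (Q a)) (hsum : ∀ v, P v + ∑ a ∈ s, Q a v = v) :
    ExactOffMiddle m n D L := by
  refine ⟨LinearMap.ext fun v => ?_, fun k i hi hk v hv hv0 => ?_⟩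
  · rw [← hsum v, map_add, map_sum, hP.1, Finset.sum_eq_zero fun a ha => (hQ a ha).1 v]
    simp
  · obtain ⟨u, hu, huv⟩ := hP.2 k i hi hk v hv hv0
    choose! w hw hwv using fun a ha => (hQ a ha).2 k i hi hk v hv hv0
    refine ⟨u + ∑ a ∈ s, w a, add_mem hu (sum_mem hw), ?_⟩
    rw [map_add, map_sum, huv, Finset.sum_congr rfl hwv, hsum]

lemma ExactOffMiddle.of_retract {m n : ℕ} {D : Module.End E N} {D' : Module.End E N'}
    {L : ℤ → Submodule E N} {L' : ℤ → Submodule E N'} (h : ExactOffMiddle m n D' L')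
    {r : N → N'} {ι : N' → N} (hr0 : r 0 = 0) (hι0 : ι 0 = 0)
    (hr : ∀ v, r (D v) = D' (r v)) (hι : ∀ v, ι (D' v) = D (ι v))
    (hrL : ∀ k, ∀ v ∈ L k, r v ∈ L' k) (hιL : ∀ k, ∀ v ∈ L' k, ι v ∈ L k)
    (hιr : ∀ v, ι (r v) = v) : ExactOffMiddle m n D L :=
  .of_components (S := Empty) (Q := fun _ => id) ∅
    (.of_retract h 0 rfl hr0 hι0 hr hι (by simpa using hrL) (by simpa using hιL))
    (by simp) (by simpa using hιr)

/-! ### The twisted double -/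

/-- The operator `(b, a) ↦ (q D b, D a + b)` on `N × N`. -/
def twistedDouble (q : E) (D : Module.End E N) : Module.End E (N × N) :=
  LinearMap.prod (q • D ∘ₗ LinearMap.fst E N N)
    (D ∘ₗ LinearMap.snd E N N + LinearMap.fst E N N)

/-- The grading of the twisted double. -/
def doubleGrading (L : ℤ → Submodule E N) (k : ℤ) : Submodule E (N × N) :=
  (L (k - 1)).prod (L k)

lemma twistedDouble_apply (q : E) (D : Module.End E N) (v : N × N) :
    twistedDouble q D v = (q • D v.1, D v.2 + v.1) := rfl

/-- The corner coefficient is the q-integer [i+1]_q, since each further step multiplies the diagonal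
entry by q and adds it to the corner. -/
lemma twistedDouble_pow_succ (q : E) (D : Module.End E N) (i : ℕ) (v : N × N) :
    (twistedDouble q D ^ (i + 1)) v = (q ^ (i + 1) • (D ^ (i + 1)) v.1,
      (D ^ (i + 1)) v.2 + (∑ j ∈ Finset.range (i + 1), q ^ j) • (D ^ i) v.1) := by
  induction i with
  | zero => simp [twistedDouble_apply]
  | succ i ih =>
    rw [pow_succ', Module.End.mul_apply, ih, twistedDouble_apply,
      Finset.sum_range_succ _ (i + 1), pow_succ' D (i + 1), Module.End.mul_apply,
      Module.End.mul_apply]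
    ext
    · simp [smul_smul, pow_succ']
    · simp only [map_add, map_smul, add_smul]
      rw [← Module.End.mul_apply D (D ^ i), ← pow_succ']
      abel

lemma pow_mem_graded {D : Module.End E N} {L : ℤ → Submodule E N}
    (hD : ∀ k, ∀ v ∈ L k, D v ∈ L (k - 1)) (i : ℕ) {k : ℤ} {v : N} (hv : v ∈ L k) :
    (D ^ i) v ∈ L (k - i) := by
  induction i with
  | zero => simpa using hv
  | succ i ih =>
    rw [pow_succ', Module.End.mul_apply]
    have := hD _ _ ih
    rwa [sub_sub, ← Nat.cast_succ] at this

variable {q : E} {D : Module.End E N} {L : ℤ → Submodule E N} {i j n : ℕ} {k : ℤ}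

/-- First half of the diagram chase: the quotient component is a boundary. -/
lemma exists_fst_boundary (h : ExactOffMiddle (i + j + 2) n D L)
    (hD : ∀ k, ∀ v ∈ L k, D v ∈ L (k - 1))
    (hi : ∑ l ∈ Finset.range (i + 1), q ^ l ≠ 0)
    (hk : OffMiddle (i + j + 2) (n + 1) k (i + 1)) {b a : N} (hb : b ∈ L (k - 1)) (ha : a ∈ L k)
    (hb0 : (D ^ (i + 1)) b = 0)
    (hab : (D ^ (i + 1)) a + (∑ l ∈ Finset.range (i + 1), q ^ l) • (D ^ i) b = 0) :
    ∃ b' ∈ L (k + j), (D ^ (j + 1)) b' = b := by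
  by_cases hk' : OffMiddle (i + j + 2) n (k - 1) (i + 1)
  · obtain ⟨u, hu, huv⟩ := h.2 (k - 1) (i + 1) (by omega) hk' b hb hb0
    refine ⟨u, ?_, ?_⟩
    · convert hu using 2; push_cast; ring
    · convert huv using 3; omega
  -- The only remaining case is the upper edge 2k - (i+1) = n + 1, where both (k-1, i) and (k, i+2)
  -- are off the middle for n. They give D^{j+2} e = Da + cb and D^j d = a, whence cb = D^{j+1}(De -
  -- d).
  · set c := ∑ l ∈ Finset.range (i + 1), q ^ l
    unfold OffMiddle at hk hk'
    obtain ⟨e, he, hea⟩ := h.2 (k - 1) i (by omega) (by unfold OffMiddle; omega) (D a + c • b)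
      (add_mem (hD _ _ ha) (Submodule.smul_mem _ _ hb))
      (by rw [map_add, map_smul, ← Module.End.mul_apply, ← pow_succ, hab])
    obtain ⟨d, hd, hda⟩ := h.2 k (i + 2) (by omega) (by unfold OffMiddle; omega) a ha (by
      rw [pow_succ', Module.End.mul_apply, eq_neg_of_add_eq_zero_left hab, map_neg, map_smul,
        ← Module.End.mul_apply, ← pow_succ', hb0, smul_zero, neg_zero])
    rw [show i + j + 2 - i = j + 1 + 1 by omega, pow_succ, Module.End.mul_apply] at hea
    rw [show i + j + 2 - (i + 2) = j by omega] at hda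
    refine ⟨c⁻¹ • (D e - d), Submodule.smul_mem _ _ (sub_mem ?_ ?_), ?_⟩
    · convert hD _ _ he using 2; push_cast; ring
    · convert hd using 2; push_cast; ring
    · rw [map_smul, map_sub, hea, pow_succ', Module.End.mul_apply D, hda, add_sub_cancel_left,
        smul_smul, inv_mul_cancel₀ hi, one_smul]

/-- Second half of the diagram chase: cycles in the subcomplex are boundaries. -/
lemma exists_snd_boundary (h : ExactOffMiddle (i + j + 2) n D L)
    (hD : ∀ k, ∀ v ∈ L k, D v ∈ L (k - 1))
    (hj : ∑ l ∈ Finset.range (j + 1), q ^ l ≠ 0)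
    (hk : OffMiddle (i + j + 2) (n + 1) k (i + 1)) {a : N} (ha : a ∈ L k)
    (ha0 : (D ^ (i + 1)) a = 0) :
    ∃ u ∈ doubleGrading L (k + (j + 1)), (twistedDouble q D ^ (j + 1)) u = (0, a) := by
  by_cases hk' : OffMiddle (i + j + 2) n k (i + 1)
  · obtain ⟨u, hu, huv⟩ := h.2 k (i + 1) (by omega) hk' a ha ha0
    rw [show i + j + 2 - (i + 1) = j + 1 by omega] at huv
    refine ⟨(0, u), ⟨zero_mem _, ?_⟩, ?_⟩
    · change u ∈ L _
      convert hu using 2; push_cast; ring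
    · simp [twistedDouble_pow_succ, huv]
  -- Here only the lower edge 2k + m - (i+1) = n + 1 remains, with m = i + j + 2. Exactness at (k-1,
  -- i) gives D^{j+2} e = Da, and exactness at (k, i+2) writes a - D^{j+1} e as D^j d. The corner
  -- coefficient c = [j+1]_q is compensated by taking c⁻¹d as first coordinate.
  · set c := ∑ l ∈ Finset.range (j + 1), q ^ l with hc
    unfold OffMiddle at hk hk'
    obtain ⟨e, he, hea⟩ := h.2 (k - 1) i (by omega) (by unfold OffMiddle; omega) (D a)
      (hD _ _ ha) (by rw [← Module.End.mul_apply, ← pow_succ, ha0])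
    rw [show i + j + 2 - i = j + 1 + 1 by omega, pow_succ', Module.End.mul_apply] at hea
    have he' : e ∈ L (k + (j + 1)) := by convert he using 2; push_cast; ring
    have h2 : D (a - (D ^ (j + 1)) e) = 0 := by rw [map_sub, hea, sub_self]
    obtain ⟨d, hd, hda⟩ := h.2 k (i + 2) (by omega) (by unfold OffMiddle; omega)
      (a - (D ^ (j + 1)) e) (sub_mem ha (by simpa using pow_mem_graded hD (j + 1) he'))
      (by rw [pow_succ, Module.End.mul_apply, h2, map_zero])
    rw [show i + j + 2 - (i + 2) = j by omega] at hda
    refine ⟨(c⁻¹ • d, e), ⟨Submodule.smul_mem _ _ ?_, he'⟩, ?_⟩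
    · convert hd using 2; push_cast; ring
    · rw [twistedDouble_pow_succ, ← hc]
      ext
      · simp only [map_smul]
        rw [pow_succ' D, Module.End.mul_apply, hda, h2, smul_zero, smul_zero]
      · simp only [map_smul]
        rw [smul_smul, mul_inv_cancel₀ hj, one_smul, hda, add_sub_cancel]

/-- Exactness away from the middle passes to the twisted double. -/
theorem ExactOffMiddle.twistedDouble {m : ℕ} (h : ExactOffMiddle m n D L)
    (hD : ∀ k, ∀ v ∈ L k, D v ∈ L (k - 1)) (hq : q ≠ 0) (hm0 : 0 < m)
    (hm : ∑ l ∈ Finset.range m, q ^ l = 0)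
    (hlt : ∀ i, 0 < i → i < m → ∑ l ∈ Finset.range i, q ^ l ≠ 0) :
    ExactOffMiddle m (n + 1) (_root_.twistedDouble q D) (doubleGrading L) := by
  have hpow : _root_.twistedDouble q D ^ m = 0 := by
    obtain ⟨m, rfl⟩ := Nat.exists_eq_succ_of_ne_zero hm0.ne'
    refine LinearMap.ext fun v => ?_
    rw [twistedDouble_pow_succ, hm, h.1]
    simp
  refine ⟨hpow, fun k i him hk v hv hv0 => ?_⟩
  -- The extreme positions are trivial: for i = 0 the cycle is zero, and for i = m every element is
  -- its own preimage.
  rcases Nat.eq_zero_or_pos i with rfl | hi0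
  · refine ⟨0, zero_mem _, ?_⟩
    rw [map_zero]
    simpa using hv0.symm
  rcases him.eq_or_lt with rfl | him
  · exact ⟨v, by simpa using hv, by simp⟩
  obtain ⟨i, rfl⟩ := Nat.exists_eq_succ_of_ne_zero hi0.ne'
  obtain ⟨j, rfl⟩ : ∃ j, m = i + j + 2 := ⟨m - i - 2, by omega⟩
  obtain ⟨b, a⟩ := v
  obtain ⟨hb, ha⟩ := hv
  have hv1 := hv0
  rw [Nat.succ_eq_add_one, twistedDouble_pow_succ, Prod.mk_eq_zero] at hv1
  obtain ⟨hb0, hab⟩ := hv1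
  rw [smul_eq_zero_iff_right (pow_ne_zero _ hq)] at hb0
  obtain ⟨b', hb', rfl⟩ := exists_fst_boundary h hD (hlt _ (by omega) (by omega)) hk hb ha hb0 hab
  set T := _root_.twistedDouble q D
  -- The scalar cancels the q^{j+1} on the diagonal, so subtracting T^{j+1} u₀ from the cycle kills
  -- its first coordinate and leaves a cycle of the subcomplex 0 × N.
  set u₀ : N × N := ((q ^ (j + 1))⁻¹ • b', 0)
  have hu₀ : (T ^ (j + 1)) u₀ = ((D ^ (j + 1)) b',
      ((∑ l ∈ Finset.range (j + 1), q ^ l) * (q ^ (j + 1))⁻¹) • (D ^ j) b') := by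
    rw [twistedDouble_pow_succ]
    ext
    · simp only [u₀, map_smul]
      rw [smul_smul, mul_inv_cancel₀ (pow_ne_zero _ hq), one_smul]
    · simp [u₀, smul_smul]
  set a₁ := a - ((∑ l ∈ Finset.range (j + 1), q ^ l) * (q ^ (j + 1))⁻¹) • (D ^ j) b' with ha₁
  have hsub : ((D ^ (j + 1)) b', a) = (T ^ (j + 1)) u₀ + (0, a₁) := by
    rw [hu₀, ha₁]
    simp
  have ha₁0 : (D ^ (i + 1)) a₁ = 0 := by
    have h1 : (T ^ (i + 1)) (0, a₁) = 0 := by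
      rw [hsub, map_add, ← Module.End.mul_apply, ← pow_add,
        show i.succ + (j + 1) = i + j + 2 by omega, hpow] at hv0
      simpa using hv0
    rw [twistedDouble_pow_succ] at h1
    simpa using congrArg Prod.snd h1
  have ha₁L : a₁ ∈ L k :=
    sub_mem ha (Submodule.smul_mem _ _ (by simpa using pow_mem_graded hD j hb'))
  obtain ⟨u₁, hu₁, hu₁a⟩ := exists_snd_boundary (q := q) h hD (hlt _ (by omega) (by omega)) hk
    ha₁L ha₁0
  refine ⟨u₀ + u₁, ?_, ?_⟩
  · rw [show k + ((i + j + 2 : ℕ) : ℤ) - (i.succ : ℕ) = k + (j + 1) by push_cast; ring]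
    refine add_mem ⟨Submodule.smul_mem _ _ ?_, zero_mem _⟩ hu₁
    rwa [show k + (j + 1 : ℤ) - 1 = k + j by ring]
  · rw [show i + j + 2 - i.succ = j + 1 by omega, map_add, hu₁a, hsub]

end Nilpotent

/-! ### Decomposition of functions on subspaces of `W × 𝔽` -/

section Decomposition

set_option linter.unusedSectionVars false

attribute [local instance] Fintype.ofFinite

open Module

variable {𝔽 : Type*} [Field 𝔽] {E : Type*} [Field E]
  {W : Type*} [AddCommGroup W] [Module 𝔽 W] [Finite W]

lemma coverSum_mem_gradedPart {V : Type*} [AddCommGroup V] [Module 𝔽 V] [Finite V] (k : ℤ)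
    (f : Submodule 𝔽 V → E) (hf : f ∈ gradedPart 𝔽 E V k) :
    coverSum 𝔽 E V f ∈ gradedPart 𝔽 E V (k - 1) := by
  classical
  intro y hy
  refine Finset.sum_eq_zero fun x hx => hf x ?_
  have := (Finset.mem_filter.1 hx).2.2
  omega

lemma dimWeight_mem_gradedPart {V : Type*} [AddCommGroup V] [Module 𝔽 V] (c : E) {k : ℤ}
    {f : Submodule 𝔽 V → E} (hf : f ∈ gradedPart 𝔽 E V k) :
    dimWeight 𝔽 c f ∈ gradedPart 𝔽 E V k :=
  fun x hx => by rw [dimWeight, hf x hx, mul_zero]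

lemma dimWeight_dimWeight {V : Type*} [AddCommGroup V] [Module 𝔽 V] {c d : E} (h : c * d = 1)
    (f : Submodule 𝔽 V → E) : dimWeight 𝔽 c (dimWeight 𝔽 d f) = f := by
  ext x
  rw [dimWeight, dimWeight, ← mul_assoc, ← mul_pow, h, one_pow, one_mul]

variable [Finite 𝔽]

lemma fourierDown_mem_gradedPart (h : W → E) {k : ℤ} {f : Submodule 𝔽 (W × 𝔽) → E}
    (hf : f ∈ gradedPart 𝔽 E _ k) : fourierDown h f ∈ gradedPart 𝔽 E W (k - 1) := by
  classical
  intro y hy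
  refine Finset.sum_eq_zero fun x hx => ?_
  by_cases hx' : x ≤ LinearMap.range (LinearMap.inl 𝔽 W 𝔽)
  · rw [affineSum_of_le hx', zero_mul]
  · obtain ⟨v, hv⟩ := exists_mem_of_not_le_range_inl hx'
    rw [hf x, mul_zero]
    rw [finrank_eq_hypTrace_add_one hv, (Finset.mem_filter.1 hx).2]
    push_cast
    omega

lemma fourierUp_mem_gradedPart (h : W → E) {k : ℤ} {g : Submodule 𝔽 W → E}
    (hg : g ∈ gradedPart 𝔽 E _ (k - 1)) : fourierUp h g ∈ gradedPart 𝔽 E (W × 𝔽) k := by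
  intro x hx
  by_cases hx' : x ≤ LinearMap.range (LinearMap.inl 𝔽 W 𝔽)
  · rw [fourierUp, affineSum_of_le hx', zero_mul, zero_mul]
  · obtain ⟨v, hv⟩ := exists_mem_of_not_le_range_inl hx'
    rw [fourierUp, hg (hypTrace x), mul_zero, mul_zero, zero_mul]
    rw [finrank_eq_hypTrace_add_one hv] at hx
    push_cast at hx
    omega

/-- The character of `W` obtained from a linear functional and an additive character of `𝔽`. -/
def dualChar (ψ : AddChar 𝔽 E) (l : Dual 𝔽 W) : W → E := fun v => ψ (l v)

variable {ψ : AddChar 𝔽 E}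

lemma dualChar_zero : dualChar ψ (0 : Dual 𝔽 W) = fun _ => 1 := by
  ext v
  simp [dualChar]

lemma dualChar_add_right (l : Dual 𝔽 W) (v u : W) :
    dualChar ψ l (v + u) = dualChar ψ l v * ψ (l u) := by
  rw [dualChar, map_add, AddChar.map_add_eq_mul, dualChar]

lemma exists_char_ne_one (hψ : ψ ≠ 1) : ∃ t, ψ t ≠ 1 := AddChar.ne_one_iff.1 hψ

/-- Translating the affine part by a vector u' of the trace with ψ (l u') ≠ 1 permutes the summands
and multiplies the sum by ψ (l u'). -/
lemma affineSum_dualChar_eq_zero (hψ : ψ ≠ 1) {l : Dual 𝔽 W} {x : Submodule 𝔽 (W × 𝔽)}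
    (hx : ¬ hypTrace x ≤ LinearMap.ker l) : affineSum (dualChar ψ l) x = 0 := by
  classical
  obtain ⟨t, ht⟩ := exists_char_ne_one hψ
  obtain ⟨u, hu, hu0⟩ := SetLike.not_le_iff_exists.1 hx
  have hu0' : l u ≠ 0 := hu0
  have hu1 : (t * (l u)⁻¹) • u ∈ hypTrace x := Submodule.smul_mem _ _ hu
  set u' := (t * (l u)⁻¹) • u with hu'
  have hlu : l u' = t := by rw [hu', map_smul, smul_eq_mul, inv_mul_cancel_right₀ hu0']
  have key : affineSum (dualChar ψ l) x = affineSum (dualChar ψ l) x * ψ t := by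
    rw [affineSum, Finset.sum_mul]
    symm
    refine Finset.sum_nbij' (fun v => v + u') (fun v => v - u') ?_ ?_ ?_ ?_ ?_
    · intro v hv
      simp only [Finset.mem_filter, Finset.mem_univ, true_and] at hv ⊢
      simpa using x.add_mem hv (mem_hypTrace.1 hu1)
    · intro v hv
      simp only [Finset.mem_filter, Finset.mem_univ, true_and] at hv ⊢
      simpa using x.sub_mem hv (mem_hypTrace.1 hu1)
    · intro v _
      simp
    · intro v _
      simp
    · intro v _
      rw [dualChar_add_right, hlu]
  by_contra h0
  exact ht (mul_left_cancel₀ h0 (by rw [← key, mul_one]))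

lemma sum_dualChar_eq_zero (hψ : ψ ≠ 1) {l : Dual 𝔽 W} (hl : l ≠ 0) :
    ∑ v, dualChar ψ l v = 0 := by
  have h := affineSum_dualChar_eq_zero (x := ⊤) hψ (l := l) fun h => hl <| by
    ext v
    exact h (x := v) (by rw [mem_hypTrace]; trivial)
  simpa [affineSum] using h

instance finite_dual : Finite (Dual 𝔽 W) := Module.finite_of_finite 𝔽

lemma sum_dual_char (hψ : ψ ≠ 1) {u : W} (hu : u ≠ 0) : ∑ l : Dual 𝔽 W, ψ (l u) = 0 := by
  obtain ⟨t, ht⟩ := exists_char_ne_one hψ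
  obtain ⟨l, hl⟩ : ∃ l : Dual 𝔽 W, l u ≠ 0 := by
    by_contra! h
    exact hu ((Module.forall_dual_apply_eq_zero_iff 𝔽 u).1 h)
  have key : ∑ l : Dual 𝔽 W, ψ (l u) = (∑ l : Dual 𝔽 W, ψ (l u)) * ψ t := by
    rw [Finset.sum_mul, ← Equiv.sum_comp (Equiv.addRight ((t * (l u)⁻¹) • l))]
    refine Finset.sum_congr rfl fun l' _ => ?_
    rw [Equiv.coe_addRight, LinearMap.add_apply, LinearMap.smul_apply, smul_eq_mul,
      inv_mul_cancel_right₀ hl, AddChar.map_add_eq_mul]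
  by_contra h0
  exact ht (mul_left_cancel₀ h0 (by rw [← key, mul_one]))

lemma sum_dual_one : ∑ _l : Dual 𝔽 W, (1 : E) = fieldCard 𝔽 E ^ finrank 𝔽 W := by
  rw [sum_one_space (𝔽 := 𝔽), Subspace.dual_finrank_eq]

open Classical in
-- Orthogonality of characters leaves q ^ dim W for each affine point common to x and x'. Two
-- subspaces with equal trace that share an affine point coincide, by `coneOver_hypTrace`.
lemma sum_affineSum_mul_affineSum (hψ : ψ ≠ 1) {x x' : Submodule 𝔽 (W × 𝔽)}
    (hx : ¬ x ≤ LinearMap.range (LinearMap.inl 𝔽 W 𝔽)) (hxx' : hypTrace x' = hypTrace x) :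
    ∑ l : Dual 𝔽 W, affineSum (dualChar ψ l) x * affineSum (dualChar ψ (-l)) x'
      = if x' = x then fieldCard 𝔽 E ^ finrank 𝔽 (hypTrace x) * fieldCard 𝔽 E ^ finrank 𝔽 W
        else 0 := by
  have h1 : ∀ v v' : W, ∑ l : Dual 𝔽 W, dualChar ψ l v * dualChar ψ (-l) v'
      = if v = v' then fieldCard 𝔽 E ^ finrank 𝔽 W else 0 := by
    intro v v'
    have h2 : ∀ l : Dual 𝔽 W, dualChar ψ l v * dualChar ψ (-l) v' = ψ (l (v - v')) := by
      intro l
      rw [dualChar, dualChar, ← AddChar.map_add_eq_mul, LinearMap.neg_apply, map_sub,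
        sub_eq_add_neg]
    simp only [h2]
    split_ifs with h
    · simp only [h, sub_self, map_zero, AddChar.map_zero_eq_one]
      exact sum_dual_one
    · exact sum_dual_char hψ (sub_ne_zero.2 h)
  simp only [affineSum, Finset.sum_mul_sum]
  rw [Finset.sum_comm]
  simp only [Finset.sum_comm (s := Finset.univ (α := Dual 𝔽 W)), h1]
  split_ifs with h
  · subst h
    rw [← affineSum_one hx, affineSum, Finset.sum_mul]
    refine Finset.sum_congr rfl fun v hv => ?_
    rw [Finset.sum_ite_eq, if_pos hv, one_mul]
  · refine Finset.sum_eq_zero fun v hv => Finset.sum_eq_zero fun v' hv' => if_neg ?_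
    rintro rfl
    rw [Finset.mem_filter] at hv hv'
    exact h (by rw [← coneOver_hypTrace hv.2, ← coneOver_hypTrace hv'.2, hxx'])

lemma fourier_inversion (hψ : ψ ≠ 1) (hq : fieldCard 𝔽 E ≠ 0) (f : Submodule 𝔽 (W × 𝔽) → E) :
    extendZero (LinearMap.inl 𝔽 W 𝔽) (restrictMap (LinearMap.inl 𝔽 W 𝔽) f)
      + ∑ l : Dual 𝔽 W, fourierUp (dualChar ψ l) (fourierDown (dualChar ψ (-l)) f) = f := by
  classical
  ext x
  rw [Pi.add_apply, Finset.sum_apply]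
  by_cases hx : x ≤ LinearMap.range (LinearMap.inl 𝔽 W 𝔽)
  · rw [Finset.sum_eq_zero, add_zero, extendZero, if_pos hx, restrictMap,
      Submodule.map_comap_eq_self hx]
    intro l _
    rw [fourierUp, affineSum_of_le hx, zero_mul, zero_mul]
  · rw [extendZero, if_neg hx, zero_add]
    simp only [fourierUp, fourierDown, Finset.mul_sum, Finset.sum_mul]
    rw [Finset.sum_comm]
    have h1 : ∀ x' ∈ Finset.univ.filter fun x' => hypTrace x' = hypTrace x,
        ∑ l : Dual 𝔽 W, affineSum (dualChar ψ l) x *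
          ((fieldCard 𝔽 E)⁻¹ ^ finrank 𝔽 (hypTrace x) *
            (affineSum (dualChar ψ (-l)) x' * f x')) * (fieldCard 𝔽 E)⁻¹ ^ finrank 𝔽 W
        = if x' = x then f x else 0 := by
      intro x' hx'
      have h2 := sum_affineSum_mul_affineSum hψ hx (Finset.mem_filter.1 hx').2
      have h3 : ∀ l : Dual 𝔽 W, affineSum (dualChar ψ l) x *
          ((fieldCard 𝔽 E)⁻¹ ^ finrank 𝔽 (hypTrace x) *
            (affineSum (dualChar ψ (-l)) x' * f x')) * (fieldCard 𝔽 E)⁻¹ ^ finrank 𝔽 W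
          = affineSum (dualChar ψ l) x * affineSum (dualChar ψ (-l)) x' *
            ((fieldCard 𝔽 E)⁻¹ ^ finrank 𝔽 (hypTrace x) * (fieldCard 𝔽 E)⁻¹ ^ finrank 𝔽 W
              * f x') := fun l => by ring
      simp only [h3]
      rw [← Finset.sum_mul, h2]
      split_ifs with h
      · subst h
        rw [← mul_assoc, inv_pow, inv_pow, mul_mul_mul_comm,
          mul_inv_cancel₀ (pow_ne_zero _ hq), mul_inv_cancel₀ (pow_ne_zero _ hq), one_mul, one_mul]
      · rw [zero_mul]
    rw [Finset.sum_congr rfl h1, Finset.sum_ite_eq', if_pos (by simp)]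

/-- The component of the trivial character, together with the hyperplane, is a twisted double. -/
lemma exactComponent_trivial (hq : fieldCard 𝔽 E ≠ 0) {m n : ℕ}
    (h : ExactOffMiddle m n (twistedDouble (fieldCard 𝔽 E) (coverSum 𝔽 E W))
      (doubleGrading (gradedPart 𝔽 E W))) :
    ExactComponent m n (coverSum 𝔽 E (W × 𝔽)) (gradedPart 𝔽 E (W × 𝔽)) (fun f =>
      extendZero (LinearMap.inl 𝔽 W 𝔽) (restrictMap (LinearMap.inl 𝔽 W 𝔽) f)
      + fourierUp (fun _ => 1) (fourierDown (fun _ => 1) f)) := by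
  classical
  set q := fieldCard 𝔽 E with hq'
  have hj : Function.Injective (LinearMap.inl 𝔽 W 𝔽) := LinearMap.inl_injective
  have hcompat : ∀ g : Submodule 𝔽 W → E, TranslationCompatible (fun _ => (1 : E)) g :=
    fun g y _ u _ v => rfl
  have h1 : (∑ _v : W, (1 : E)) * q⁻¹ ^ finrank 𝔽 W = 1 := by
    rw [sum_one_space (𝔽 := 𝔽), ← mul_pow, mul_inv_cancel₀ hq, one_pow]
  have h2 : ∀ g : Submodule 𝔽 W → E, dimWeight 𝔽 q (dimWeight 𝔽 q⁻¹ g) = g :=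
    dimWeight_dimWeight (mul_inv_cancel₀ hq)
  -- The inserted pair of weights changes nothing in total. The weight q⁻¹ ^ dim makes the operator
  -- on the first coordinate q • D, and turns the q ^ dim affine points of each cover leaving the
  -- hyperplane into the coefficient 1.
  suffices h3 : ExactComponent m n (coverSum 𝔽 E (W × 𝔽)) (gradedPart 𝔽 E (W × 𝔽)) (fun f =>
      extendZero (LinearMap.inl 𝔽 W 𝔽) (restrictMap (LinearMap.inl 𝔽 W 𝔽) f)
      + fourierUp (fun _ => 1) (dimWeight 𝔽 q (dimWeight 𝔽 q⁻¹ (fourierDown (fun _ => 1) f)))) by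
    simpa only [h2] using h3
  refine ExactComponent.of_retract (N' := (Submodule 𝔽 W → E) × (Submodule 𝔽 W → E)) h 0 rfl
    (r := fun f => (dimWeight 𝔽 q⁻¹ (fourierDown (fun _ => 1) f),
      restrictMap (LinearMap.inl 𝔽 W 𝔽) f))
    (ι := fun v => extendZero (LinearMap.inl 𝔽 W 𝔽) v.2
      + fourierUp (fun _ => 1) (dimWeight 𝔽 q v.1)) ?_ ?_ ?_ ?_ ?_ ?_
  · refine Prod.ext ?_ rfl
    ext x
    simp [dimWeight, fourierDown]
  · ext x
    simp [extendZero, fourierUp, dimWeight]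
  · intro f
    rw [twistedDouble_apply]
    refine Prod.ext ?_ ?_
    · simp only
      rw [fourierDown_coverSum, coverSum_dimWeight, smul_smul, mul_inv_cancel₀ hq, one_smul]
    · ext y
      simp only
      rw [restrictMap_coverSum hj, Pi.add_apply]
      congr 1
      rw [dimWeight, fourierDown, Finset.mul_sum, Finset.sum_filter, Finset.sum_filter]
      refine Finset.sum_congr rfl fun x _ => ?_
      by_cases hx : x ≤ LinearMap.range (LinearMap.inl 𝔽 W 𝔽)
      · simp only [hx, not_true_eq_false, and_false, if_false, affineSum_of_le hx, zero_mul,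
          mul_zero, ite_self]
      · simp only [hx, not_false_eq_true, and_true, isCover_map_inl_iff hx]
        split_ifs with hxy
        · rw [affineSum_one hx, hxy, ← mul_assoc, ← mul_pow, inv_mul_cancel₀ hq, one_pow, one_mul]
        · rfl
  · intro v
    rw [twistedDouble_apply, map_add, coverSum_extendZero hj, coverSum_fourierUp hq (hcompat _),
      coverSum_dimWeight, dimWeight_dimWeight (inv_mul_cancel₀ hq), h1, one_smul]
    ext x
    simp only [Pi.add_apply, extendZero, fourierUp, dimWeight, Pi.smul_apply, smul_eq_mul]
    split_ifs <;> ring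
  · intro k f hf
    rw [Nat.cast_zero, sub_zero]
    exact ⟨dimWeight_mem_gradedPart _ (fourierDown_mem_gradedPart _ hf),
      restrictMap_mem_gradedPart hj hf⟩
  · intro k v hv
    rw [Nat.cast_zero, sub_zero] at hv
    exact add_mem (extendZero_mem_gradedPart hj hv.2)
      (fourierUp_mem_gradedPart _ (dimWeight_mem_gradedPart _ hv.1))

/-- The component of a nontrivial character comes from the kernel of the functional. -/
lemma exactComponent_nontrivial (hψ : ψ ≠ 1) (hq : fieldCard 𝔽 E ≠ 0) {m n : ℕ} {l : Dual 𝔽 W}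
    (hl : l ≠ 0) (h : ExactOffMiddle m n (coverSum 𝔽 E (LinearMap.ker l))
      (gradedPart 𝔽 E (LinearMap.ker l))) :
    ExactComponent m (n + 2) (coverSum 𝔽 E (W × 𝔽)) (gradedPart 𝔽 E (W × 𝔽)) (fun f =>
      fourierUp (dualChar ψ l) (fourierDown (dualChar ψ (-l)) f)) := by
  classical
  set j := (LinearMap.ker l).subtype with hj'
  have hj : Function.Injective j := Subtype.val_injective
  have hrange : LinearMap.range j = LinearMap.ker l := Submodule.range_subtype _
  have hker : LinearMap.ker (-l) = LinearMap.ker l := by ext; simp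
  -- The character is nontrivial on any trace not contained in ker l, so its affine sums there
  -- vanish and the component lives on subspaces of ker l.
  have hdown : ∀ f : Submodule 𝔽 (W × 𝔽) → E, ∀ y, ¬ y ≤ LinearMap.range j →
      fourierDown (dualChar ψ (-l)) f y = 0 := by
    intro f y hy
    refine Finset.sum_eq_zero fun x hx => ?_
    rw [affineSum_dualChar_eq_zero hψ, zero_mul]
    rwa [(Finset.mem_filter.1 hx).2, hker, ← hrange]
  have hcompat : ∀ g : Submodule 𝔽 (LinearMap.ker l) → E,
      TranslationCompatible (dualChar ψ l) (extendZero j g) := by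
    intro g y hy u hu v
    have hy' : y ≤ LinearMap.range j := by
      by_contra hc
      exact hy (if_neg hc)
    have : l u = 0 := by
      have := hy' hu
      rwa [hrange] at this
    rw [dualChar_add_right, this, AddChar.map_zero_eq_one, mul_one]
  convert ExactComponent.of_retract h 1 rfl
    (r := fun f => restrictMap j (fourierDown (dualChar ψ (-l)) f))
    (ι := fun g => fourierUp (dualChar ψ l) (extendZero j g)) ?_ ?_ ?_ ?_ ?_ ?_ using 2 with f
  · rw [extendZero_restrictMap (hdown f)]
  · ext x
    simp [restrictMap, fourierDown]
  · ext x
    simp [extendZero, fourierUp]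
  · intro f
    ext y
    rw [fourierDown_coverSum, restrictMap_coverSum hj, Finset.sum_eq_zero, add_zero]
    intro x hx
    exact hdown f x (Finset.mem_filter.1 hx).2.2
  · intro g
    -- A nontrivial character sums to zero over W, so the correction term disappears.
    rw [coverSum_fourierUp hq (hcompat g), sum_dualChar_eq_zero hψ hl, zero_mul, zero_smul,
      add_zero, coverSum_extendZero hj]
  · intro k f hf
    exact restrictMap_mem_gradedPart hj (fourierDown_mem_gradedPart _ hf)
  · intro k g hg
    exact fourierUp_mem_gradedPart _ (extendZero_mem_gradedPart hj hg)

end Decomposition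

/-! ### Exactness away from the middle -/

section Exactness

attribute [local instance] Fintype.ofFinite

open Module

variable {𝔽 : Type u} [Field 𝔽] {E : Type*} [Field E]

lemma exactOffMiddle_of_equiv {V V' : Type*} [AddCommGroup V] [Module 𝔽 V] [Finite V]
    [AddCommGroup V'] [Module 𝔽 V'] [Finite V'] (e : V ≃ₗ[𝔽] V') {m n : ℕ}
    (h : ExactOffMiddle m n (coverSum 𝔽 E V') (gradedPart 𝔽 E V')) :
    ExactOffMiddle m n (coverSum 𝔽 E V) (gradedPart 𝔽 E V) := by
  classical
  refine h.of_retract (r := restrictMap (e.symm : V' →ₗ[𝔽] V))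
    (ι := restrictMap (e : V →ₗ[𝔽] V')) rfl rfl ?_ ?_ ?_ ?_ ?_
  · intro f
    ext y
    rw [restrictMap_coverSum e.symm.injective]
    simp
  · intro f
    ext y
    rw [restrictMap_coverSum e.injective]
    simp
  · exact fun k f hf => restrictMap_mem_gradedPart e.symm.injective hf
  · exact fun k f hf => restrictMap_mem_gradedPart e.injective hf
  · intro f
    ext y
    simp only [restrictMap, ← Submodule.map_comp]
    simp

lemma exactOffMiddle_of_finrank_zero {V : Type*} [AddCommGroup V] [Module 𝔽 V] [Finite V]
    [Finite 𝔽] (hV : finrank 𝔽 V = 0) {m : ℕ} (hm : 0 < m) :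
    ExactOffMiddle m 0 (coverSum 𝔽 E V) (gradedPart 𝔽 E V) := by
  classical
  have h0 : ∀ x : Submodule 𝔽 V, finrank 𝔽 x = 0 := fun x =>
    Nat.le_zero.1 (hV ▸ Submodule.finrank_le x)
  have hD : coverSum 𝔽 E V = 0 := by
    refine LinearMap.ext fun f => funext fun y => Finset.sum_eq_zero fun x hx => ?_
    have := (Finset.mem_filter.1 hx).2.2
    rw [h0, h0] at this
    omega
  refine ⟨by rw [hD, zero_pow hm.ne'], fun k i hi hk v hv hv0 => ?_⟩
  by_cases hk0 : k = 0
  -- In degree 0 with n = 0, being off the middle forces i = 0 or i = m.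
  · unfold OffMiddle at hk
    subst hk0
    rcases Nat.eq_zero_or_pos i with rfl | hi0
    · exact ⟨0, zero_mem _, by rw [map_zero]; simpa using hv0.symm⟩
    · obtain rfl : i = m := by omega
      exact ⟨v, by simpa using hv, by simp⟩
  · refine ⟨0, zero_mem _, ?_⟩
    rw [map_zero]
    ext x
    exact (hv x (by rw [h0]; exact fun h => hk0 h.symm)).symm

variable [Finite 𝔽] {ψ : AddChar 𝔽 E}

/-- Induction from n - 1 and n to n + 1: the trivial character reduces to the twisted double over W
of dimension n, each nonzero functional to its kernel of dimension n - 1. The field E must carry a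
nontrivial additive character of 𝔽. -/
theorem exactOffMiddle_coverSum (hψ : ψ ≠ 1) (hq : fieldCard 𝔽 E ≠ 0) {m : ℕ} (hm0 : 0 < m)
    (hm : ∑ l ∈ Finset.range m, fieldCard 𝔽 E ^ l = 0)
    (hlt : ∀ i, 0 < i → i < m → ∑ l ∈ Finset.range i, fieldCard 𝔽 E ^ l ≠ 0) (n : ℕ) :
    ∀ (V : Type u) [AddCommGroup V] [Module 𝔽 V] [Finite V], finrank 𝔽 V = n →
      ExactOffMiddle m n (coverSum 𝔽 E V) (gradedPart 𝔽 E V) := by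
  classical
  induction n using Nat.strong_induction_on with
  | _ n ih =>
    intro V _ _ _ hV
    rcases Nat.eq_zero_or_pos n with rfl | hn
    · exact exactOffMiddle_of_finrank_zero hV hm0
    obtain ⟨n, rfl⟩ := Nat.exists_eq_succ_of_ne_zero hn.ne'
    have hW : finrank 𝔽 (Fin n → 𝔽) = n := by simp
    refine exactOffMiddle_of_equiv (V' := (Fin n → 𝔽) × 𝔽)
      (LinearEquiv.ofFinrankEq _ _ (by rw [hV, finrank_prod, hW, finrank_self])) ?_
    refine ExactOffMiddle.of_components (Finset.univ.erase (0 : Dual 𝔽 (Fin n → 𝔽)))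
      (exactComponent_trivial hq ((ih n (by omega) _ hW).twistedDouble
        (fun k v => coverSum_mem_gradedPart k v) hq hm0 hm hlt))
      (Q := fun l f => fourierUp (dualChar ψ l) (fourierDown (dualChar ψ (-l)) f)) ?_ ?_
    · intro l hl
      have hl0 : l ≠ 0 := Finset.ne_of_mem_erase hl
      have hker : finrank 𝔽 (LinearMap.ker l) + 1 = n := by
        exact (Module.Dual.finrank_ker_add_one_of_ne_zero hl0).trans hW
      have h2 := exactComponent_nontrivial hψ hq hl0 (ih (n - 1) (by omega) _ (by omega))
      rwa [show n - 1 + 2 = n + 1 by omega] at h2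
    · intro f
      conv_rhs => rw [← fourier_inversion hψ hq f]
      rw [add_assoc, ← Finset.add_sum_erase _ _ (Finset.mem_univ (0 : Dual 𝔽 (Fin n → 𝔽))),
        neg_zero, dualChar_zero]

end Exactness

/-! ### Exactness away from the middle for the incidence map -/

section IncidenceExactness

attribute [local instance] Fintype.ofFinite

open Module

/-- The operator has coefficients 0 and 1, so it commutes with any F-linear retraction π : E → F. A
preimage found over E is pushed down by π. -/
lemma exactOffMiddle_descend {𝔽 : Type*} [Field 𝔽] {F E : Type*} [Field F] [Field E] [Algebra F E]
    {V : Type*} [AddCommGroup V] [Module 𝔽 V] [Finite V] {m n : ℕ}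
    (h : ExactOffMiddle m n (coverSum 𝔽 E V) (gradedPart 𝔽 E V)) :
    ExactOffMiddle m n (coverSum 𝔽 F V) (gradedPart 𝔽 F V) := by
  classical
  obtain ⟨π, hπ⟩ := (Algebra.linearMap F E).exists_leftInverse_of_injective
    (LinearMap.ker_eq_bot.2 (algebraMap F E).injective)
  have hπ' : ∀ a, π (algebraMap F E a) = a := fun a => LinearMap.congr_fun hπ a
  have hup : ∀ (i : ℕ) (f : Submodule 𝔽 V → F), algebraMap F E ∘ ((coverSum 𝔽 F V ^ i) f)
      = (coverSum 𝔽 E V ^ i) (algebraMap F E ∘ f) := by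
    refine fun i f => pow_comm_of_comm (r := fun f => algebraMap F E ∘ f) (fun f => ?_) i f
    ext y
    simp [coverSum_apply]
  have hdown : ∀ (i : ℕ) (f : Submodule 𝔽 V → E), π ∘ ((coverSum 𝔽 E V ^ i) f)
      = (coverSum 𝔽 F V ^ i) (π ∘ f) := by
    refine fun i f => pow_comm_of_comm (r := fun f => π ∘ f) (fun f => ?_) i f
    ext y
    simp [coverSum_apply]
  have hinj : ∀ f g : Submodule 𝔽 V → F, algebraMap F E ∘ f = algebraMap F E ∘ g → f = g :=
    fun f g hfg => (algebraMap F E).injective.comp_left hfg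
  refine ⟨LinearMap.ext fun f => hinj _ _ ?_, fun k i hi hk f hf hf0 => ?_⟩
  · rw [hup, h.1]
    ext
    simp
  · obtain ⟨u, hu, huf⟩ := h.2 k i hi hk (algebraMap F E ∘ f)
      (fun x hx => by rw [Function.comp_apply, hf x hx, map_zero])
      (by rw [← hup, hf0]; ext; simp)
    refine ⟨π ∘ u, fun x hx => by rw [Function.comp_apply, hu x hx, map_zero], ?_⟩
    rw [← hdown, huf]
    ext x
    exact hπ' _

variable (F 𝔽 : Type u) [Field F] [Field 𝔽] (n : ℕ)

lemma mem_levelModule {k : ℤ} {f : TotalModule F 𝔽 n} : f ∈ levelModule F 𝔽 n k ↔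
    ∀ x : Subsp 𝔽 n, (finrank 𝔽 x : ℤ) ≠ k → (permBasis F (Subsp 𝔽 n)).repr f x = 0 := by
  rw [levelModule, Basis.mem_span_image]
  constructor
  · intro h x hx
    by_contra hc
    exact hx (h (Finsupp.mem_support_iff.2 hc))
  · intro h x hx
    by_contra hc
    exact Finsupp.mem_support_iff.1 hx (h x hc)

variable [Finite 𝔽]

/-- Summing over subspaces of x on basis vectors becomes, on coordinates, summing over the covers of
y. -/
lemma equivFun_incidenceMap (f : TotalModule F 𝔽 n) :
    (permBasis F (Subsp 𝔽 n)).equivFun (incidenceMap F 𝔽 n f)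
      = coverSum 𝔽 F _ ((permBasis F (Subsp 𝔽 n)).equivFun f) := by
  classical
  set b := permBasis F (Subsp 𝔽 n)
  suffices h : b.equivFun.toLinearMap ∘ₗ incidenceMap F 𝔽 n
      = coverSum 𝔽 F _ ∘ₗ b.equivFun.toLinearMap from LinearMap.congr_fun h f
  refine b.ext fun x => ?_
  ext y
  simp only [LinearMap.comp_apply, LinearEquiv.coe_coe, incidenceMap, b, Basis.constr_basis,
    map_sum, Finset.sum_apply, Basis.equivFun_self, coverSum_apply]
  rw [Finset.sum_ite_eq', Finset.sum_ite_eq]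
  refine if_congr ?_ rfl rfl
  rw [Set.Finite.mem_toFinset, Finset.mem_filter]
  exact ⟨fun h => ⟨Finset.mem_univ _, h⟩, fun h => h.2⟩

lemma exactOffMiddle_incidenceMap {m : ℕ}
    (h : ExactOffMiddle m n (coverSum 𝔽 F (Fin n → 𝔽)) (gradedPart 𝔽 F (Fin n → 𝔽))) :
    ExactOffMiddle m n (incidenceMap F 𝔽 n) (levelModule F 𝔽 n) := by
  set b := permBasis F (Subsp 𝔽 n)
  refine h.of_retract (r := b.equivFun) (ι := b.equivFun.symm) (map_zero _) (map_zero _)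
    (equivFun_incidenceMap F 𝔽 n) ?_ ?_ ?_ ?_
  · intro g
    rw [LinearEquiv.symm_apply_eq, equivFun_incidenceMap, LinearEquiv.apply_symm_apply]
  · exact fun k f hf => (mem_levelModule F 𝔽 n).1 hf
  · intro k g hg
    refine (mem_levelModule F 𝔽 n).2 fun x hx => ?_
    rw [← Basis.equivFun_apply, LinearEquiv.apply_symm_apply]
    exact hg x hx
  · exact fun f => LinearEquiv.symm_apply_apply _ _

variable {F 𝔽 n} {p : ℕ}

lemma ringChar_ne_of_not_dvd_card [CharP F p] (hpq : ¬ p ∣ Nat.card 𝔽) :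
    ringChar F ≠ ringChar 𝔽 := by
  rw [ringChar.eq F p]
  rintro h
  have : CharP 𝔽 p := by rw [h]; infer_instance
  refine hpq ((CharP.cast_eq_zero_iff 𝔽 p _).1 ?_)
  rw [Nat.card_eq_fintype_card]
  exact FiniteField.cast_card_eq_zero 𝔽

variable [Fact p.Prime]

lemma quantumChar_mem {q : ℕ} (hq : ¬ p ∣ q) :
    1 < quantumChar p q ∧ ∑ j ∈ Finset.range (quantumChar p q), (q : ZMod p) ^ j = 0 := by
  have hp := Fact.out (p := p.Prime)
  refine Nat.sInf_mem (s := {i : ℕ | 1 < i ∧ ∑ j ∈ Finset.range i, (q : ZMod p) ^ j = 0})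
    -- This length works for every q: if q ≡ 1 the sum is p(p - 1) ≡ 0, and otherwise q^{p-1} ≡ 1
    -- annihilates the geometric sum.
    ⟨p * (p - 1), ?_, ?_⟩
  · have := hp.two_le
    nlinarith [Nat.sub_add_cancel hp.one_lt.le]
  · have hq0 : (q : ZMod p) ≠ 0 := by rwa [Ne, ZMod.natCast_eq_zero_iff]
    by_cases h1 : (q : ZMod p) = 1
    · simp [h1]
    · refine mul_right_cancel₀ (sub_ne_zero.2 h1) ?_
      rw [geom_sum_mul, mul_comm p, pow_mul, ZMod.pow_card_sub_one_eq_one hq0]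
      simp

lemma geomSum_cast_eq_zero_iff {E : Type*} [Field E] [CharP E p] (q i : ℕ) :
    ∑ j ∈ Finset.range i, (q : E) ^ j = 0 ↔ ∑ j ∈ Finset.range i, (q : ZMod p) ^ j = 0 := by
  have h1 := CharP.cast_eq_zero_iff E p (∑ j ∈ Finset.range i, q ^ j)
  have h2 := CharP.cast_eq_zero_iff (ZMod p) p (∑ j ∈ Finset.range i, q ^ j)
  push_cast at h1 h2
  rw [h1, h2]

lemma geomSum_ne_zero_of_lt_quantumChar {q i : ℕ} (hi0 : 0 < i) (hi : i < quantumChar p q) :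
    ∑ j ∈ Finset.range i, (q : ZMod p) ^ j ≠ 0 := by
  intro h
  -- Minimality only covers i > 1; for i = 1 the sum is 1.
  rcases (Nat.succ_le_of_lt hi0).eq_or_lt with rfl | h1
  · simp at h
  · exact Nat.notMem_of_lt_sInf hi ⟨h1, h⟩

/-- The incidence homology vanishes away from the middle indices. -/
theorem exactOffMiddle_of_charP [CharP F p] (hpq : ¬ p ∣ Nat.card 𝔽) (n : ℕ) :
    ExactOffMiddle (quantumChar p (Nat.card 𝔽)) n (incidenceMap F 𝔽 n) (levelModule F 𝔽 n) := by
  -- The character takes values in a cyclotomic extension of F; it exists because the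
  -- characteristics of F and 𝔽 differ.
  set ψ := AddChar.FiniteField.primitiveChar 𝔽 F (ringChar_ne_of_not_dvd_card hpq)
  have hψ : ψ.char ≠ 1 := by
    have := ψ.prim one_ne_zero
    rwa [AddChar.mulShift_one] at this
  have : CharP (CyclotomicField ψ.n F) p :=
    charP_of_injective_algebraMap (algebraMap F (CyclotomicField ψ.n F)).injective p
  refine exactOffMiddle_incidenceMap F 𝔽 n (exactOffMiddle_descend (E := CyclotomicField ψ.n F) ?_)
  have hm := quantumChar_mem hpq
  refine exactOffMiddle_coverSum hψ ?_ (by omega) ((geomSum_cast_eq_zero_iff _ _).2 hm.2)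
    (fun i hi0 hi => mt (geomSum_cast_eq_zero_iff _ _).1
      (geomSum_ne_zero_of_lt_quantumChar hi0 hi)) n _ (by simp)
  rwa [fieldCard, Ne, CharP.cast_eq_zero_iff _ p]

end IncidenceExactness

/-! ### Additive invariants of representations -/

section AdditiveInvariant

variable {F : Type u} {G : Type v} [Field F] [Group G] {A : Type w} [AddCommGroup A]

/-- A function on finite-dimensional representations that is additive on short exact sequences. -/
def IsAdditiveInvariant
    (Φ : ∀ (V : Type u) [AddCommGroup V] [Module F V] [FiniteDimensional F V],
      Representation F G V → A) : Prop :=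
  ∀ (V₁ V₂ V₃ : Type u) [AddCommGroup V₁] [Module F V₁] [FiniteDimensional F V₁]
    [AddCommGroup V₂] [Module F V₂] [FiniteDimensional F V₂]
    [AddCommGroup V₃] [Module F V₃] [FiniteDimensional F V₃]
    (ρ₁ : Representation F G V₁) (ρ₂ : Representation F G V₂) (ρ₃ : Representation F G V₃)
    (f : V₁ →ₗ[F] V₂) (h : V₂ →ₗ[F] V₃), (∀ g a, f (ρ₁ g a) = ρ₂ g (f a)) →
    (∀ g b, h (ρ₂ g b) = ρ₃ g (h b)) → Function.Injective f → Function.Exact f h →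
    Function.Surjective h → Φ V₂ ρ₂ = Φ V₁ ρ₁ + Φ V₃ ρ₃

theorem isAdditiveInvariant_repClass :
    IsAdditiveInvariant (F := F) (G := G) (fun _ _ _ _ ρ => repClass ρ) := by
  intro V₁ V₂ V₃ _ _ _ _ _ _ _ _ _ ρ₁ ρ₂ ρ₃ f h hf hh hinj hex hsurj
  have h1 : FreeAbelianGroup.of (toSkeleton (FDRep.of ρ₂))
      - FreeAbelianGroup.of (toSkeleton (FDRep.of ρ₁))
      - FreeAbelianGroup.of (toSkeleton (FDRep.of ρ₃)) ∈ shortExactRelations F G :=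
    ⟨FDRep.of ρ₁, FDRep.of ρ₂, FDRep.of ρ₃, f, h, hf, hh, hinj, hex, hsurj, rfl⟩
  have h2 := Ideal.Quotient.eq_zero_iff_mem.2 (Ideal.subset_span h1)
  rw [map_sub, map_sub, sub_sub, sub_eq_zero] at h2
  exact h2

/-- Equal submodules carry different types; this transports Φ along an equality of submodules
without using additivity. -/
lemma subrepresentation_invariant_congr {A : Type w}
    (Φ : ∀ (V : Type u) [AddCommGroup V] [Module F V] [FiniteDimensional F V],
      Representation F G V → A) {V : Type u} [AddCommGroup V] [Module F V] [FiniteDimensional F V]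
    {ρ : Representation F G V} {W U : Submodule F V} (hWU : W = U)
    (hW : ∀ g, W ≤ W.comap (ρ g)) (hU : ∀ g, U ≤ U.comap (ρ g)) :
    Φ W (ρ.subrepresentation W hW) = Φ U (ρ.subrepresentation U hU) := by
  subst hWU
  rfl

namespace IsAdditiveInvariant

variable {Φ : ∀ (V : Type u) [AddCommGroup V] [Module F V] [FiniteDimensional F V],
  Representation F G V → A} (hΦ : IsAdditiveInvariant Φ)
include hΦ

variable {V V' : Type u} [AddCommGroup V] [Module F V] [FiniteDimensional F V]
  [AddCommGroup V'] [Module F V'] [FiniteDimensional F V']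

/-- For V = 0 the sequence 0 → V → V → V → 0 is exact, so Φ = Φ + Φ. -/
lemma eq_zero_of_subsingleton [Subsingleton V] (ρ : Representation F G V) : Φ V ρ = 0 := by
  have h := hΦ V V V ρ ρ ρ LinearMap.id LinearMap.id (fun _ _ => rfl) (fun _ _ => rfl)
    Function.injective_id (fun a => ⟨fun _ => ⟨a, rfl⟩, fun _ => Subsingleton.elim _ _⟩)
    Function.surjective_id
  simpa using h

lemma congr (ρ : Representation F G V) (ρ' : Representation F G V') (e : V ≃ₗ[F] V')
    (he : ∀ g a, e (ρ g a) = ρ' g (e a)) : Φ V ρ = Φ V' ρ' := by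
  have h := hΦ V V' PUnit ρ ρ' 1 e 0 he (fun _ _ => rfl) e.injective
    (fun a => ⟨fun _ => ⟨e.symm a, by simp⟩, fun _ => rfl⟩) (fun a => ⟨0, rfl⟩)
  rw [h, hΦ.eq_zero_of_subsingleton (V := PUnit), add_zero]

variable {ρ : Representation F G V}

lemma eq_ker_add_map {W K I : Submodule F V} (hW : ∀ g, W ≤ W.comap (ρ g))
    (hK : ∀ g, K ≤ K.comap (ρ g)) (hI : ∀ g, I ≤ I.comap (ρ g)) (D : V →ₗ[F] V)
    (hD : ∀ g a, D (ρ g a) = ρ g (D a)) (hKW : K = LinearMap.ker D ⊓ W) (hIW : I = W.map D) :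
    Φ W (ρ.subrepresentation W hW)
      = Φ K (ρ.subrepresentation K hK) + Φ I (ρ.subrepresentation I hI) := by
  subst hKW hIW
  refine hΦ _ _ _ _ _ _ (Submodule.inclusion inf_le_right)
    (D.restrict (p := W) (q := W.map D) fun x hx => ⟨x, hx, rfl⟩) (fun g a => rfl)
    (fun g b => Subtype.ext (hD g b)) (Submodule.inclusion_injective _) ?_ ?_
  · rintro ⟨b, hb⟩
    constructor
    · intro h
      exact ⟨⟨b, congrArg Subtype.val h, hb⟩, rfl⟩
    · rintro ⟨a, ha⟩
      obtain rfl : (a : V) = b := congrArg Subtype.val ha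
      exact Subtype.ext a.2.1
  · rintro ⟨_, a, ha, rfl⟩
    exact ⟨⟨a, ha⟩, rfl⟩

lemma eq_add_quotient {W U : Submodule F V} (hW : ∀ g, W ≤ W.comap (ρ g))
    (hU : ∀ g, U ≤ U.comap (ρ g)) (hUW : U ≤ W)
    (hQ : ∀ g, U.submoduleOf W ≤ (U.submoduleOf W).comap (ρ.subrepresentation W hW g)) :
    Φ W (ρ.subrepresentation W hW) = Φ U (ρ.subrepresentation U hU)
      + Φ (W ⧸ U.submoduleOf W) ((ρ.subrepresentation W hW).quotient (U.submoduleOf W) hQ) := by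
  refine hΦ _ _ _ _ _ _ (Submodule.inclusion hUW) (U.submoduleOf W).mkQ (fun g a => rfl)
    (fun g b => rfl) (Submodule.inclusion_injective _) ?_ (Submodule.mkQ_surjective _)
  intro b
  rw [Submodule.mkQ_apply, Submodule.Quotient.mk_eq_zero]
  constructor
  · intro h
    exact ⟨⟨b, h⟩, rfl⟩
  · rintro ⟨a, rfl⟩
    exact a.2

lemma subrepresentation_eq_zero {W : Submodule F V} (h : W = ⊥)
    (hW : ∀ g, W ≤ W.comap (ρ g)) : Φ W (ρ.subrepresentation W hW) = 0 := by
  subst h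
  exact hΦ.eq_zero_of_subsingleton _

end IsAdditiveInvariant

end AdditiveInvariant

/-! ### The trace formula for additive invariants -/

section TraceFormula

lemma finite_setOf_mem_Icc (n : ℕ) {m : ℕ} (hm : 0 < m) (r : ℤ) :
    {t : ℤ | 0 ≤ r + t * m ∧ r + t * m ≤ n}.Finite := by
  refine Set.Finite.preimage (f := fun t : ℤ => r + t * m) ?_ (Set.finite_Icc (0 : ℤ) n)
  intro a _ b _ hab
  have hm' : (m : ℤ) ≠ 0 := by exact_mod_cast hm.ne'
  exact mul_right_cancel₀ hm' (add_left_cancel hab)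

/-- The Hopf trace argument: if all but one of the homology contributions vanish, the remaining one
is an alternating sum of the chain contributions. -/
lemma eq_finsum_sub_finsum {A : Type*} [AddCommGroup A] {n m i : ℕ} {k : ℤ} {M : ℤ → A}
    {K I : ℤ → ℕ → A} {H : A} (hi0 : 0 < i) (him : i < m)
    (hK0 : ∀ (r : ℤ), ∀ j ≤ m, ¬ (0 ≤ r ∧ r ≤ n) → K r j = 0)
    (hI0 : ∀ (r : ℤ), ∀ j ≤ m, ¬ (0 ≤ r ∧ r ≤ n) → I r j = 0)
    (hM : ∀ (r : ℤ) (j : ℕ), 0 < j → j < m → M r = K r j + I (r - j) (m - j))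
    (hH : K k i = I k i + H) (hKI : ∀ t : ℤ, t ≠ 0 → K (k + t * m) i = I (k + t * m) i)
    (hKI' : ∀ t : ℤ, K (k - i + t * m) (m - i) = I (k - i + t * m) (m - i)) :
    H = (∑ᶠ t : ℤ, M (k + t * m)) - ∑ᶠ t : ℤ, M (k - i + t * m) := by
  have hm : 0 < m := by omega
  have hfin : ∀ (X : ℤ → ℕ → A), (∀ (r : ℤ), ∀ j ≤ m, ¬ (0 ≤ r ∧ r ≤ n) → X r j = 0) →
      ∀ (r : ℤ), ∀ j ≤ m, (Function.support fun t : ℤ => X (r + t * m) j).Finite :=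
    fun X hX r j hj =>
    (finite_setOf_mem_Icc n hm r).subset fun t ht => by
      by_contra hc
      exact ht (hX _ _ hj hc)
  -- The I-terms of `h1` and `h2` cancel: those with index m - i match directly, those with index i
  -- after the shift t ↦ t + 1 in `h3`. What is left is the sum of K - I over the positions (k + tm,
  -- i), where only t = 0 contributes.
  have h1 : ∀ t : ℤ, M (k + t * m) = K (k + t * m) i + I (k - i + t * m) (m - i) := fun t => by
    rw [hM _ i hi0 him, show k + t * m - i = k - i + t * m by ring]
  have h2 : ∀ t : ℤ, M (k - i + t * m)
      = I (k - i + t * m) (m - i) + I (k - m + t * m) i := fun t => by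
    rw [hM _ (m - i) (by omega) (by omega), hKI', Nat.sub_sub_self him.le, Nat.cast_sub him.le,
      show k - i + t * m - ((m : ℤ) - i) = k - m + t * m by ring]
  have h3 : ∑ᶠ t : ℤ, I (k - m + t * m) i = ∑ᶠ t : ℤ, I (k + t * m) i := by
    rw [← finsum_comp_equiv (Equiv.addRight (1 : ℤ))]
    refine finsum_congr fun t => ?_
    rw [Equiv.coe_addRight, show k - m + (t + 1) * m = k + t * m by ring]
  have hKf := fun r => hfin K hK0 r i him.le
  have hIf := fun r => hfin I hI0 r i him.le
  have hIf' := fun r => hfin I hI0 r (m - i) (Nat.sub_le _ _)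
  rw [finsum_congr h1, finsum_congr h2, finsum_add_distrib (hKf _) (hIf' _),
    finsum_add_distrib (hIf' _) (hIf _), h3, add_comm (∑ᶠ t : ℤ, K _ _),
    add_sub_add_left_eq_sub, ← finsum_sub_distrib (hKf _) (hIf _), finsum_eq_single _ 0]
  · simp [hH]
  · intro t ht
    rw [hKI t ht, sub_self]

variable {F 𝔽 : Type u} [Field F] [Field 𝔽] {n : ℕ} {m : ℕ}

lemma levelModule_eq_bot {r : ℤ} (hr : ¬ (0 ≤ r ∧ r ≤ n)) : levelModule F 𝔽 n r = ⊥ := by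
  rw [eq_bot_iff]
  intro f hf
  rw [mem_levelModule] at hf
  rw [Submodule.mem_bot, ← (permBasis F (Subsp 𝔽 n)).repr.map_eq_zero_iff]
  ext x
  refine hf x fun hx => hr ⟨by omega, ?_⟩
  have := Submodule.finrank_le x
  rw [Module.finrank_fin_fun] at this
  omega

variable [Finite 𝔽]

lemma incidenceMap_pow_mem (j : ℕ) {r : ℤ} {f : TotalModule F 𝔽 n}
    (hf : f ∈ levelModule F 𝔽 n r) : (incidenceMap F 𝔽 n ^ j) f ∈ levelModule F 𝔽 n (r - j) := by
  refine pow_mem_graded (fun r f hf => (mem_levelModule F 𝔽 n).2 ?_) j hf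
  have h := coverSum_mem_gradedPart r _ ((mem_levelModule F 𝔽 n).1 hf :
    (permBasis F (Subsp 𝔽 n)).equivFun f ∈ gradedPart 𝔽 F _ r)
  intro x hx
  rw [← Module.Basis.equivFun_apply, equivFun_incidenceMap]
  exact h x hx

lemma boundaries_le_level {r : ℤ} {j : ℕ} (hj : j ≤ m) :
    boundaries F 𝔽 n m r j ≤ levelModule F 𝔽 n r := by
  rintro _ ⟨f, hf, rfl⟩
  have h := incidenceMap_pow_mem (m - j) hf
  rwa [Nat.cast_sub hj, show r + m - j - ((m : ℤ) - j) = r by ring] at h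

variable (hE : ExactOffMiddle m n (incidenceMap F 𝔽 n) (levelModule F 𝔽 n))
include hE

lemma boundaries_le_cycles {r : ℤ} {j : ℕ} (hj : j ≤ m) :
    boundaries F 𝔽 n m r j ≤ cycles F 𝔽 n r j := by
  refine le_inf ?_ (boundaries_le_level hj)
  rintro _ ⟨f, _, rfl⟩
  rw [LinearMap.mem_ker, ← Module.End.mul_apply, ← pow_add, Nat.add_sub_cancel' hj, hE.1,
    LinearMap.zero_apply]

lemma cycles_eq_boundaries {r : ℤ} {j : ℕ} (hj : j ≤ m) (hr : OffMiddle m n r j) :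
    cycles F 𝔽 n r j = boundaries F 𝔽 n m r j :=
  le_antisymm (fun f hf => hE.2 r j hj hr f hf.2 hf.1) (boundaries_le_cycles hE hj)

/-- Each M_r has the invariant of its cycles plus that of its image under a power of ∂, and off the
middle cycles equal boundaries. It remains to see that (k, i) is the only middle position met. -/
theorem IsAdditiveInvariant.homologyRep_eq {A : Type w} [AddCommGroup A]
    {Φ : ∀ (V : Type u) [AddCommGroup V] [Module F V] [FiniteDimensional F V],
      Representation F (GL (Fin n) 𝔽) V → A} (hΦ : IsAdditiveInvariant Φ) {k : ℤ} {i : ℕ}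
    (hki : IsMiddleIndex n m k i) :
    Φ _ (homologyRep F 𝔽 n m k i) = (∑ᶠ t : ℤ, Φ _ (levelRep F 𝔽 n (k + t * m)))
      - ∑ᶠ t : ℤ, Φ _ (levelRep F 𝔽 n (k - i + t * m)) := by
  obtain ⟨hk, ⟨hi0, him⟩, hlt, hgt⟩ := hki
  refine eq_finsum_sub_finsum (n := n) (M := fun r => Φ _ (levelRep F 𝔽 n r))
    (K := fun r j => Φ _ (cyclesRep F 𝔽 n r j))
    (I := fun r j => Φ _ ((totalRep F 𝔽 n).subrepresentation (boundaries F 𝔽 n m r j)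
      (boundaries_invariant F 𝔽 n m r j))) hi0 him ?_ ?_ ?_ ?_ ?_ ?_
  · intro r j _ hr
    refine hΦ.subrepresentation_eq_zero ?_ _
    rw [cycles, levelModule_eq_bot hr, inf_bot_eq]
  · intro r j hj hr
    exact hΦ.subrepresentation_eq_zero
      (le_bot_iff.1 ((boundaries_le_level hj).trans (levelModule_eq_bot hr).le)) _
  · intro r j hj0 hjm
    refine hΦ.eq_ker_add_map _ _ _ (incidenceMap F 𝔽 n ^ j) (incidenceMap_pow_comm F 𝔽 n j) rfl ?_
    rw [boundaries, Nat.sub_sub_self hjm.le, Nat.cast_sub hjm.le]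
    congr 2
    ring
  · exact hΦ.eq_add_quotient _ _ (boundaries_le_cycles hE him.le) _
  · intro t ht
    refine subrepresentation_invariant_congr Φ (cycles_eq_boundaries hE him.le ?_) _ _
    -- The quantity 2k + m - i lies in the open interval (n, n + m), and moving it by 2tm with t ≠ 0
    -- takes it out.
    have ht' : (m : ℤ) ≤ t * m ∨ t * m ≤ -m := by
      rcases lt_or_gt_of_ne ht with h | h
      · right; nlinarith
      · left; nlinarith
    unfold OffMiddle
    omega
  · intro t
    refine subrepresentation_invariant_congr Φ (cycles_eq_boundaries hE (Nat.sub_le _ _) ?_) _ _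
    -- At these positions the tested quantity is 2k - i + 2tm with n - m < 2k - i < n: at most n for
    -- t ≤ 0, at least n + m for t ≥ 1.
    have ht' : (m : ℤ) ≤ t * m ∨ t * m ≤ 0 := by
      rcases le_or_gt t 0 with h | h
      · right; nlinarith
      · left; nlinarith
    unfold OffMiddle
    omega

end TraceFormula

/-! ### Brauer characters -/

section BrauerAdditive

open Module Polynomial

variable {F : Type*} [Field F]

open Module.Basis in
-- In a basis of W completed by lifts of a basis of V ⧸ W, the matrix of e is block upper
-- triangular.
theorem charpoly_eq_charpoly_mul_charpoly {V : Type*} [AddCommGroup V] [Module F V]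
    [FiniteDimensional F V] (W : Submodule F V) (e : V →ₗ[F] V) (he : W ≤ W.comap e) :
    e.charpoly = (e.restrict he).charpoly * (W.mapQ W e he).charpoly := by
  classical
  let m := Module.Free.ChooseBasisIndex F W
  let bW : Basis m F W := Module.Free.chooseBasis F W
  let n := Module.Free.ChooseBasisIndex F (V ⧸ W)
  let bQ : Basis n F (V ⧸ W) := Module.Free.chooseBasis F (V ⧸ W)
  let b := sumQuot bW bQ
  let A : Matrix m m F := LinearMap.toMatrix bW bW (e.restrict he)
  let B : Matrix m n F := Matrix.of fun i l ↦
    ((sumQuot bW bQ).repr (e ((sumQuot bW bQ) (Sum.inr l)))) (Sum.inl i)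
  let D : Matrix n n F := LinearMap.toMatrix bQ bQ (W.mapQ W e he)
  suffices LinearMap.toMatrix b b e = Matrix.fromBlocks A B 0 D by
    rw [← LinearMap.charpoly_toMatrix e b, this, ← LinearMap.charpoly_toMatrix _ bW,
      ← LinearMap.charpoly_toMatrix _ bQ, Matrix.charpoly_fromBlocks_zero₂₁]
  ext u v
  cases u with
  | inl i =>
    cases v with
    | inl k =>
      simp only [b, sumQuot_inl, Matrix.fromBlocks_apply₁₁, A, LinearMap.toMatrix_apply]
      apply sumQuot_repr_inl_of_mem
    | inr l => simp [b, LinearMap.toMatrix_apply, Matrix.fromBlocks_apply₁₂, B]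
  | inr j =>
    cases v with
    | inl k =>
      suffices W.mkQ (e (bW k)) = 0 by simp [LinearMap.toMatrix_apply, b, this]
      rw [← LinearMap.mem_ker, Submodule.ker_mkQ]
      exact he (Submodule.coe_mem (bW k))
    | inr l =>
      simp only [LinearMap.toMatrix_apply, sumQuot_repr_inr,
        Matrix.fromBlocks_apply₂₂, b, D]
      rw [← sumQuot_inr bW bQ l, W.mapQ_apply]
      simp

theorem charpoly_of_exact {V₁ V₂ V₃ : Type*} [AddCommGroup V₁] [Module F V₁]
    [FiniteDimensional F V₁] [AddCommGroup V₂] [Module F V₂] [FiniteDimensional F V₂]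
    [AddCommGroup V₃] [Module F V₃] [FiniteDimensional F V₃] {φ₁ : V₁ →ₗ[F] V₁}
    {φ₂ : V₂ →ₗ[F] V₂} {φ₃ : V₃ →ₗ[F] V₃} {f : V₁ →ₗ[F] V₂} {h : V₂ →ₗ[F] V₃}
    (hf : ∀ a, f (φ₁ a) = φ₂ (f a)) (hh : ∀ b, h (φ₂ b) = φ₃ (h b))
    (hinj : Function.Injective f) (hex : Function.Exact f h) (hsurj : Function.Surjective h) :
    φ₂.charpoly = φ₁.charpoly * φ₃.charpoly := by
  have hker : LinearMap.ker h ≤ (LinearMap.ker h).comap φ₂ := fun b hb => by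
    rw [Submodule.mem_comap, LinearMap.mem_ker, hh, LinearMap.mem_ker.1 hb, map_zero]
  let e₁ : V₁ ≃ₗ[F] LinearMap.ker h :=
    (LinearEquiv.ofInjective f hinj).trans (LinearEquiv.ofEq _ _ hex.linearMap_ker_eq.symm)
  let e₃ : (V₂ ⧸ LinearMap.ker h) ≃ₗ[F] V₃ := h.quotKerEquivOfSurjective hsurj
  have h1 : e₁.conj φ₁ = φ₂.restrict hker := by
    refine LinearMap.ext fun b => ?_
    obtain ⟨a, rfl⟩ := e₁.surjective b
    rw [LinearEquiv.conj_apply_apply, LinearEquiv.symm_apply_apply]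
    exact Subtype.ext (hf a)
  have h3 : e₃.conj ((LinearMap.ker h).mapQ _ φ₂ hker) = φ₃ := by
    refine LinearMap.ext fun c => ?_
    obtain ⟨b, rfl⟩ := hsurj c
    have hb : e₃.symm (h b) = Submodule.Quotient.mk b := by
      rw [LinearEquiv.symm_apply_eq]
      rfl
    rw [LinearEquiv.conj_apply_apply, hb, Submodule.mapQ_apply, ← hh]
    rfl
  rw [charpoly_eq_charpoly_mul_charpoly (LinearMap.ker h) φ₂ hker, ← h1,
    LinearEquiv.charpoly_conj, ← LinearEquiv.charpoly_conj e₃, h3]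

variable {K : Type*} [Field K]

/-- The sum of the lifts of the roots of a polynomial. -/
def liftedRootSum (θ : CommGroup.torsion (AlgebraicClosure F)ˣ →* K) (P : F[X]) : K :=
  ((P.map (algebraMap F (AlgebraicClosure F))).roots.map (liftEigenvalue θ)).sum

lemma liftedRootSum_mul (θ : CommGroup.torsion (AlgebraicClosure F)ˣ →* K) {P Q : F[X]}
    (hP : P.Monic) (hQ : Q.Monic) :
    liftedRootSum θ (P * Q) = liftedRootSum θ P + liftedRootSum θ Q := by
  rw [liftedRootSum, Polynomial.map_mul, Polynomial.roots_mul, Multiset.map_add, Multiset.sum_add]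
  · rfl
  · exact mul_ne_zero (hP.map _).ne_zero (hQ.map _).ne_zero

end BrauerAdditive

/-! ### Additivity of the Brauer character and sums of lifted roots of unity -/

section BrauerPermutation

open Module Polynomial

theorem isAdditiveInvariant_brauerCharacter {F : Type u} [Field F] {G : Type v} [Group G]
    {K : Type w} [Field K] (θ : CommGroup.torsion (AlgebraicClosure F)ˣ →* K) (g : G) :
    IsAdditiveInvariant (F := F) (G := G) (fun _ _ _ _ ρ => brauerCharacter θ ρ g) := by
  intro V₁ V₂ V₃ _ _ _ _ _ _ _ _ _ ρ₁ ρ₂ ρ₃ f h hf hh hinj hex hsurj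
  change liftedRootSum θ _ = liftedRootSum θ _ + liftedRootSum θ _
  rw [charpoly_of_exact (hf g) (hh g) hinj hex hsurj,
    liftedRootSum_mul θ (LinearMap.charpoly_monic _) (LinearMap.charpoly_monic _)]

variable {F : Type*} [Field F] {K : Type*} [Field K]
  (θ : CommGroup.torsion (AlgebraicClosure F)ˣ →* K)

lemma liftEigenvalue_coe (u : CommGroup.torsion (AlgebraicClosure F)ˣ) :
    liftEigenvalue θ ((u : (AlgebraicClosure F)ˣ) : AlgebraicClosure F) = θ u := by
  have h : ∃ u' : CommGroup.torsion (AlgebraicClosure F)ˣ,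
      ((u' : (AlgebraicClosure F)ˣ) : AlgebraicClosure F)
        = ((u : (AlgebraicClosure F)ˣ) : AlgebraicClosure F) := ⟨u, rfl⟩
  rw [liftEigenvalue, dif_pos h]
  congr 1
  exact Subtype.ext (Units.ext h.choose_spec)

/-- A root of unity as an element of the torsion subgroup. -/
def torsionOfPowEqOne {L : Type*} [Field L] {x : L} {l : ℕ} (hl : l ≠ 0) (hx : x ^ l = 1) :
    CommGroup.torsion Lˣ :=
  ⟨Units.ofPowEqOne x l hx hl, (isOfFinOrder_iff_pow_eq_one).2
    ⟨l, Nat.pos_of_ne_zero hl, Units.pow_ofPowEqOne hx hl⟩⟩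

variable {θ}

lemma liftEigenvalue_mul {x y : AlgebraicClosure F} {l : ℕ} (hl : l ≠ 0) (hx : x ^ l = 1)
    (hy : y ^ l = 1) :
    liftEigenvalue θ (x * y) = liftEigenvalue θ x * liftEigenvalue θ y := by
  have h1 := liftEigenvalue_coe θ (torsionOfPowEqOne hl hx)
  have h2 := liftEigenvalue_coe θ (torsionOfPowEqOne hl hy)
  have h3 := liftEigenvalue_coe θ (torsionOfPowEqOne hl hx * torsionOfPowEqOne hl hy)
  rw [map_mul, ← h1, ← h2] at h3
  exact h3

lemma liftEigenvalue_one : liftEigenvalue θ 1 = 1 := by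
  have h := liftEigenvalue_coe θ 1
  rwa [map_one] at h

lemma liftEigenvalue_ne_one (hθ : Function.Injective θ) {x : AlgebraicClosure F} {l : ℕ}
    (hl : l ≠ 0) (hx : x ^ l = 1) (hx1 : x ≠ 1) : liftEigenvalue θ x ≠ 1 := by
  have h1 := liftEigenvalue_coe θ (torsionOfPowEqOne hl hx)
  intro h
  rw [show ((torsionOfPowEqOne hl hx : (AlgebraicClosure F)ˣ) : AlgebraicClosure F) = x from rfl,
    h, ← map_one θ] at h1
  exact hx1 (congrArg (fun u : CommGroup.torsion (AlgebraicClosure F)ˣ =>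
    ((u : (AlgebraicClosure F)ˣ) : AlgebraicClosure F)) (hθ h1)).symm

open Classical in
-- As l is invertible in F, the polynomial has l distinct roots. Multiplication by a primitive root
-- ζ permutes them and scales the sum by θ ζ, which differs from 1 by injectivity when l ≠ 1.
lemma liftedRootSum_X_pow_sub_one (hθ : Function.Injective θ) {l : ℕ} (hl : (l : F) ≠ 0) :
    liftedRootSum θ (X ^ l - 1 : F[X]) = if l = 1 then 1 else 0 := by
  set L := AlgebraicClosure F
  have hl0 : l ≠ 0 := by
    rintro rfl
    simp at hl
  split_ifs with h1
  · subst h1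
    have h2 : ((X ^ 1 - 1 : F[X]).map (algebraMap F L)).roots = {1} := by
      rw [pow_one, Polynomial.map_sub, Polynomial.map_X, Polynomial.map_one, ← C_1, roots_X_sub_C]
    rw [liftedRootSum, h2, Multiset.map_singleton, Multiset.sum_singleton, liftEigenvalue_one]
  · have hlL : (l : L) ≠ 0 := by
      rw [← map_natCast (algebraMap F L)]
      exact (_root_.map_ne_zero _).2 hl
    have : NeZero (l : L) := ⟨hlL⟩
    obtain ⟨ζ, hζ⟩ := HasEnoughRootsOfUnity.exists_primitiveRoot L l
    have h2 : ((X ^ l - 1 : F[X]).map (algebraMap F L)).roots = nthRoots l (1 : L) := by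
      rw [Polynomial.map_sub, Polynomial.map_pow, Polynomial.map_X, Polynomial.map_one, nthRoots,
        C_1]
    have h3 : nthRoots l (1 : L) = (nthRootsFinset l (1 : L)).val := by
      rw [nthRootsFinset, Multiset.toFinset_val, hζ.nthRoots_one_nodup.dedup]
    have hmem : ∀ x : L, x ∈ nthRootsFinset l (1 : L) ↔ x ^ l = 1 :=
      fun x => mem_nthRootsFinset (Nat.pos_of_ne_zero hl0) 1
    rw [liftedRootSum, h2, h3]
    change ∑ x ∈ nthRootsFinset l (1 : L), liftEigenvalue θ x = 0
    have key : ∑ x ∈ nthRootsFinset l (1 : L), liftEigenvalue θ x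
        = liftEigenvalue θ ζ * ∑ x ∈ nthRootsFinset l (1 : L), liftEigenvalue θ x := by
      rw [Finset.mul_sum]
      symm
      refine Finset.sum_nbij' (fun x => ζ * x) (fun x => ζ⁻¹ * x) ?_ ?_ ?_ ?_ ?_
      · intro x hx
        rw [hmem] at hx ⊢
        rw [mul_pow, hx, hζ.pow_eq_one, one_mul]
      · intro x hx
        rw [hmem] at hx ⊢
        rw [mul_pow, hx, inv_pow, hζ.pow_eq_one, inv_one, one_mul]
      · exact fun x _ => inv_mul_cancel_left₀ (hζ.ne_zero hl0) x
      · exact fun x _ => mul_inv_cancel_left₀ (hζ.ne_zero hl0) x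
      · intro x hx
        rw [liftEigenvalue_mul hl0 hζ.pow_eq_one ((hmem x).1 hx)]
    by_contra h0
    refine liftEigenvalue_ne_one hθ hl0 hζ.pow_eq_one (hζ.ne_one (by omega)) ?_
    exact mul_right_cancel₀ h0 (by rw [← key, one_mul])

end BrauerPermutation

/-! ### Characteristic polynomials and Brauer characters of permutations -/

section PermutationCharacter

open Module Polynomial

attribute [local instance] Fintype.ofFinite

variable {F : Type*} [Field F]

lemma charpoly_eq_of_basis {X V : Type*} [Finite X] [AddCommGroup V] [Module F V]
    [FiniteDimensional F V] (b : Basis X F V) {σ : Equiv.Perm X} {φ : V →ₗ[F] V}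
    (hφ : ∀ x, φ (b x) = b (σ x)) : φ.charpoly = (Finsupp.lmapDomain F F σ).charpoly := by
  rw [← LinearEquiv.charpoly_conj b.repr]
  congr 1
  refine Finsupp.lhom_ext' fun x => LinearMap.ext_ring ?_
  simp [LinearEquiv.conj_apply, hφ]

lemma charpoly_lmapDomain_eq_mul {X : Type*} [Finite X] (σ : Equiv.Perm X) (P : X → Prop)
    (hP : ∀ x, P (σ x) ↔ P x) :
    (Finsupp.lmapDomain F F σ).charpoly = (Finsupp.lmapDomain F F (σ.subtypePerm hP)).charpoly
      * (Finsupp.lmapDomain F F (σ.subtypePerm (p := fun x => ¬ P x)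
        fun x => not_congr (hP x))).charpoly := by
  classical
  rw [← LinearMap.charpoly_prodMap]
  let b := ((Finsupp.basisSingleOne (R := F) (ι := {x // P x})).prod
    (Finsupp.basisSingleOne (R := F) (ι := {x // ¬ P x}))).reindex (Equiv.sumCompl P)
  refine (charpoly_eq_of_basis b fun x => ?_).symm
  by_cases hx : P x
  · simp [b, hx, hP]
  · simp [b, hx, hP]

/-- The characteristic polynomial of a cyclic permutation. -/
lemma charpoly_lmapDomain_of_transitive {X : Type*} [Finite X] (σ : Equiv.Perm X) (x₀ : X)
    (h : ∀ y, ∃ j : ℕ, (σ ^ j) x₀ = y) :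
    (Finsupp.lmapDomain F F σ).charpoly = Polynomial.X ^ Function.minimalPeriod σ x₀ - 1 := by
  classical
  set l := Function.minimalPeriod σ x₀ with hl
  set T : Module.End F (X →₀ F) := Finsupp.lmapDomain F F σ with hT
  have hper : x₀ ∈ Function.periodicPts σ := σ.injective.mem_periodicPts x₀
  have hl0 : 0 < l := Function.minimalPeriod_pos_of_mem_periodicPts hper
  have hiter : ∀ (j : ℕ) (x : X), (σ ^ j) x = σ^[j] x := fun j x => by
    rw [Equiv.Perm.iterate_eq_pow]
  have hinj : Function.Injective fun j : Fin l => (σ ^ (j : ℕ)) x₀ := fun a b hab => by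
    simp only [hiter] at hab
    exact Fin.ext (Function.iterate_injOn_Iio_minimalPeriod a.2 b.2 hab)
  have hsurj : Function.Surjective fun j : Fin l => (σ ^ (j : ℕ)) x₀ := fun y => by
    obtain ⟨j, rfl⟩ := h y
    refine ⟨⟨j % l, Nat.mod_lt _ hl0⟩, ?_⟩
    simp only [hiter]
    exact Function.iterate_mod_minimalPeriod_eq
  have hTpow : ∀ (j : ℕ) (x : X), (T ^ j) (Finsupp.single x 1) = Finsupp.single ((σ ^ j) x) 1 := by
    intro j x
    induction j with
    | zero => simp
    | succ j ih =>
      rw [pow_succ', Module.End.mul_apply, ih, pow_succ', Equiv.Perm.mul_apply, hT,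
        Finsupp.lmapDomain_apply, Finsupp.mapDomain_single]
  have hcard : finrank F (X →₀ F) = l := by
    rw [Module.finrank_finsupp_self, ← Fintype.card_of_bijective ⟨hinj, hsurj⟩, Fintype.card_fin]
  have hTl : T ^ l = 1 := by
    refine Finsupp.lhom_ext' fun y => LinearMap.ext_ring ?_
    obtain ⟨j, rfl⟩ := h y
    simp only [LinearMap.comp_apply, Finsupp.lsingle_apply, hTpow, Module.End.one_apply]
    rw [← Equiv.Perm.mul_apply, ← pow_add, add_comm, pow_add, Equiv.Perm.mul_apply, hiter l,
      Function.iterate_minimalPeriod]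
  have hli : LinearIndependent F fun j : Fin l => (T ^ (j : ℕ)) (Finsupp.single x₀ 1) := by
    simp only [hTpow]
    exact ((Finsupp.basisSingleOne (R := F) (ι := X)).linearIndependent.comp _ hinj)
  -- The point x₀ is a cyclic vector: its first l translates are independent, so no nonzero
  -- polynomial of degree below l kills T. The characteristic polynomial and X^l - 1 are monic of
  -- degree l and both kill T, so their difference is zero.
  have hmin : ∀ P : F[X], P.natDegree < l → aeval T P = 0 → P = 0 := by
    intro P hP hP0
    have h1 : ∑ j : Fin l, P.coeff j • (T ^ (j : ℕ)) (Finsupp.single x₀ 1) = 0 := by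
      have h2 := LinearMap.congr_fun hP0 (Finsupp.single x₀ 1)
      rw [aeval_eq_sum_range' hP, LinearMap.sum_apply, Finset.sum_range] at h2
      simpa using h2
    ext j
    by_cases hj : j < l
    · exact Fintype.linearIndependent_iff.1 hli _ h1 ⟨j, hj⟩
    · exact coeff_eq_zero_of_natDegree_lt (by omega)
  have hmonic : (Polynomial.X ^ l - 1 : F[X]).Monic := by
    simpa using monic_X_pow_sub_C (1 : F) hl0.ne'
  have hdeg : (Polynomial.X ^ l - 1 : F[X]).natDegree = l := by
    simpa using natDegree_X_pow_sub_C (n := l) (r := (1 : F))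
  refine sub_eq_zero.1 (hmin _ ?_ ?_)
  · have h3 : (T.charpoly - (Polynomial.X ^ l - 1)).degree < T.charpoly.degree := by
      refine degree_sub_lt_left ?_ T.charpoly_monic.ne_zero ?_
      · rw [degree_eq_natDegree T.charpoly_monic.ne_zero, degree_eq_natDegree hmonic.ne_zero, hdeg,
          LinearMap.charpoly_natDegree, hcard]
      · rw [T.charpoly_monic.leadingCoeff, hmonic.leadingCoeff]
    by_cases h0 : T.charpoly - (Polynomial.X ^ l - 1) = 0
    · rw [h0, natDegree_zero]
      exact hl0
    · have h4 := natDegree_lt_natDegree h0 h3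
      rwa [LinearMap.charpoly_natDegree, hcard] at h4
  · rw [map_sub, LinearMap.aeval_self_charpoly, map_sub, map_pow, aeval_X, hTl]
    simp

variable {K : Type*} [Field K] {θ : CommGroup.torsion (AlgebraicClosure F)ˣ →* K}

open Classical in
-- The cycle length divides N and is therefore invertible in F. A transitive σ has a fixed point
-- only if X is a single point, which is the case of length 1.
lemma liftedRootSum_charpoly_of_transitive (hθ : Function.Injective θ) {X : Type*} [Finite X]
    (σ : Equiv.Perm X) {N : ℕ} (hN : (N : F) ≠ 0) (hσ : σ ^ N = 1) (x₀ : X)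
    (h : ∀ y, ∃ j : ℕ, (σ ^ j) x₀ = y) :
    liftedRootSum θ (Finsupp.lmapDomain F F σ).charpoly = ∑ x, if σ x = x then 1 else 0 := by
  have hdvd : Function.minimalPeriod σ x₀ ∣ N := by
    refine Function.IsPeriodicPt.minimalPeriod_dvd ?_
    rw [Function.IsPeriodicPt, Function.IsFixedPt, Equiv.Perm.iterate_eq_pow, hσ,
      Equiv.Perm.one_apply]
  have hl : ((Function.minimalPeriod σ x₀ : ℕ) : F) ≠ 0 := by
    obtain ⟨c, hc⟩ := hdvd
    intro h0
    rw [hc, Nat.cast_mul, h0, zero_mul] at hN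
    exact hN rfl
  have hfix : ∀ j : ℕ, σ x₀ = x₀ → (σ ^ j) x₀ = x₀ := fun j h0 => by
    induction j with
    | zero => simp
    | succ j ih => rw [pow_succ, Equiv.Perm.mul_apply, h0, ih]
  rw [charpoly_lmapDomain_of_transitive σ x₀ h, liftedRootSum_X_pow_sub_one hθ hl]
  split_ifs with h1
  · rw [Function.minimalPeriod_eq_one_iff_isFixedPt] at h1
    have hall : ∀ y, y = x₀ := fun y => by
      obtain ⟨j, rfl⟩ := h y
      exact hfix j h1
    rw [Finset.sum_eq_single x₀ (fun y _ hy => absurd (hall y) hy) (by simp),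
      if_pos (show σ x₀ = x₀ from h1)]
  · refine (Finset.sum_eq_zero fun y _ => if_neg fun hy => h1 ?_).symm
    rw [Function.minimalPeriod_eq_one_iff_isFixedPt]
    obtain ⟨j, rfl⟩ := h y
    refine (σ ^ j).injective ?_
    rw [← Equiv.Perm.mul_apply, ← pow_succ, pow_succ', Equiv.Perm.mul_apply, hy]

open Classical in
lemma sum_ite_eq_natCard {X : Type*} [Finite X] (P : X → Prop) :
    ∑ x, (if P x then 1 else 0 : K) = Nat.card {x // P x} := by
  rw [Finset.sum_boole, Nat.card_eq_fintype_card, Fintype.card_subtype]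

open Classical in
/-- The Brauer character of a permutation module counts fixed points. -/
theorem liftedRootSum_charpoly_lmapDomain (hθ : Function.Injective θ) {N : ℕ} (hN : (N : F) ≠ 0)
    (c : ℕ) : ∀ (X : Type w) [Finite X], Nat.card X = c → ∀ σ : Equiv.Perm X, σ ^ N = 1 →
      liftedRootSum θ (Finsupp.lmapDomain F F σ).charpoly
        = ∑ x, if σ x = x then 1 else 0 := by
  induction c using Nat.strong_induction_on with
  | _ c ih =>
    intro X _ hX σ hσ
    rcases isEmpty_or_nonempty X with hE | ⟨⟨x₀⟩⟩
    · rw [(LinearMap.charpoly_monic _).natDegree_eq_zero.1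
        (by rw [LinearMap.charpoly_natDegree]; simp)]
      simp [liftedRootSum]
    -- The cycle of x₀ is split off; its complement is σ-stable and strictly smaller, so the
    -- induction hypothesis applies to it.
    have hP : ∀ x, σ.SameCycle x₀ (σ x) ↔ σ.SameCycle x₀ x := fun x =>
      Equiv.Perm.sameCycle_apply_right
    have hpow1 : σ.subtypePerm hP ^ N = 1 := by
      rw [Equiv.Perm.subtypePerm_pow]
      ext x
      simp [hσ]
    have hpow2 : σ.subtypePerm (p := fun x => ¬ σ.SameCycle x₀ x)
        (fun x => not_congr (hP x)) ^ N = 1 := by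
      rw [Equiv.Perm.subtypePerm_pow]
      ext x
      simp [hσ]
    rw [charpoly_lmapDomain_eq_mul σ _ hP,
      liftedRootSum_mul θ (LinearMap.charpoly_monic _) (LinearMap.charpoly_monic _),
      liftedRootSum_charpoly_of_transitive hθ _ hN hpow1 ⟨x₀, Equiv.Perm.SameCycle.refl σ x₀⟩,
      ih _ ?_ _ rfl _ hpow2, ← Fintype.sum_subtype_add_sum_subtype (σ.SameCycle x₀)]
    · refine congrArg₂ _ (Finset.sum_congr (Finset.ext fun x => by simp only [Finset.mem_univ]) fun x _ => ?_)
        (Finset.sum_congr (Finset.ext fun x => by simp only [Finset.mem_univ]) fun x _ => ?_)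
      all_goals simp [Subtype.ext_iff]
    · rw [← hX, Nat.card_eq_fintype_card, Nat.card_eq_fintype_card]
      exact Fintype.card_subtype_lt (x := x₀) (not_not.2 (Equiv.Perm.SameCycle.refl σ x₀))
    · rintro ⟨y, hy⟩
      obtain ⟨j, hj⟩ := hy.exists_nat_pow_eq
      refine ⟨j, ?_⟩
      rw [Equiv.Perm.subtypePerm_pow]
      exact Subtype.ext hj

end PermutationCharacter

/-! ### The level modules as permutation modules -/

section Level

open Module

attribute [local instance] Fintype.ofFinite

variable (F 𝔽 : Type u) [Field F] [Field 𝔽] (n : ℕ) (k : ℤ)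

/-- The action of `GL(n, 𝔽)` on the `k`-dimensional subspaces. -/
def levelAction : GL (Fin n) 𝔽 →* Equiv.Perm {x : Subsp 𝔽 n // (finrank 𝔽 x : ℤ) = k} where
  toFun g := (subspAction 𝔽 n g).subtypePerm fun x => by rw [finrank_subspAction]
  map_one' := by
    ext x : 2
    simp
  map_mul' g h := by
    ext x : 2
    change subspAction 𝔽 n (g * h) x = subspAction 𝔽 n g (subspAction 𝔽 n h x)
    rw [map_mul]
    rfl

/-- The `k`-dimensional subspaces as a basis of the level module. -/
def levelBasis : Basis {x : Subsp 𝔽 n // (finrank 𝔽 x : ℤ) = k} F (levelModule F 𝔽 n k) :=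
  (Basis.span ((permBasis F (Subsp 𝔽 n)).linearIndependent.comp
    (Subtype.val : {x : Subsp 𝔽 n // (finrank 𝔽 x : ℤ) = k} → Subsp 𝔽 n)
    Subtype.val_injective)).map (LinearEquiv.ofEq _ _ (by
      rw [levelModule, Set.range_comp]
      congr 2
      exact Subtype.range_coe))

lemma coe_levelBasis (x : {x : Subsp 𝔽 n // (finrank 𝔽 x : ℤ) = k}) :
    (levelBasis F 𝔽 n k x : TotalModule F 𝔽 n) = permBasis F (Subsp 𝔽 n) x := by
  simp [levelBasis, Basis.span_apply]

lemma levelRep_levelBasis (g : GL (Fin n) 𝔽) (x : {x : Subsp 𝔽 n // (finrank 𝔽 x : ℤ) = k}) :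
    levelRep F 𝔽 n k g (levelBasis F 𝔽 n k x)
      = levelBasis F 𝔽 n k (levelAction 𝔽 n k g x) := by
  refine Subtype.ext ?_
  rw [coe_levelBasis]
  change totalRep F 𝔽 n g (levelBasis F 𝔽 n k x) = _
  rw [coe_levelBasis, permRep_apply_basis]
  rfl

variable [Finite 𝔽]

theorem repClass_levelRep_mem_burnsideRing :
    repClass (levelRep F 𝔽 n k) ∈ burnsideRing F (GL (Fin n) 𝔽) := by
  refine Subring.subset_closure ⟨_, inferInstance, levelAction 𝔽 n k, ?_⟩
  refine isAdditiveInvariant_repClass.congr _ _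
    ((levelBasis F 𝔽 n k).equiv (permBasis F _) (Equiv.refl _)) fun g a => ?_
  set b := levelBasis F 𝔽 n k
  set e := b.equiv (permBasis F _) (Equiv.refl _)
  suffices h : e.toLinearMap ∘ₗ levelRep F 𝔽 n k g
      = permRep F (levelAction 𝔽 n k) g ∘ₗ e.toLinearMap from LinearMap.congr_fun h a
  refine b.ext fun x => ?_
  simp only [LinearMap.comp_apply, LinearEquiv.coe_coe, e, Basis.equiv_apply, Equiv.refl_apply,
    permRep_apply_basis, b, levelRep_levelBasis]

theorem brauerCharacter_levelRep {K : Type w} [Field K]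
    {θ : CommGroup.torsion (AlgebraicClosure F)ˣ →* K} (hθ : Function.Injective θ)
    (g : GL (Fin n) 𝔽) (hg : ((orderOf g : ℕ) : F) ≠ 0) :
    brauerCharacter θ (levelRep F 𝔽 n k) g = fixedCount 𝔽 n k g := by
  classical
  change liftedRootSum θ _ = _
  rw [charpoly_eq_of_basis (levelBasis F 𝔽 n k) (levelRep_levelBasis F 𝔽 n k g),
    liftedRootSum_charpoly_lmapDomain hθ hg _ _ rfl _
      (by rw [← map_pow, pow_orderOf_eq_one, map_one]), sum_ite_eq_natCard, fixedCount]
  congr 1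
  refine Nat.card_congr ((Equiv.subtypeEquivRight fun x => ?_).trans
    (Equiv.subtypeSubtypeEquivSubtypeInter _ fun x => subspAction 𝔽 n g x = x))
  rw [Subtype.ext_iff]
  rfl

end Level

end

theorem mainTheorem5 (p : ℕ) [Fact p.Prime]
    (F : Type u) [Field F] [CharP F p]
    (𝔽 : Type u) [Field 𝔽] [Finite 𝔽] (hpq : ¬ p ∣ Nat.card 𝔽)
    (n m : ℕ) (hm : m = quantumChar p (Nat.card 𝔽))
    (k : ℤ) (i : ℕ) (hki : IsMiddleIndex n m k i) :
    (∀ r : ℤ, {t : ℤ | levelModule F 𝔽 n (r + t * m) ≠ ⊥}.Finite) ∧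
    repClass (homologyRep F 𝔽 n m k i) ∈ burnsideRing F (GL (Fin n) 𝔽) ∧
    repClass (homologyRep F 𝔽 n m k i)
      = (∑ᶠ t : ℤ, repClass (levelRep F 𝔽 n (k + t * m)))
        - (∑ᶠ t : ℤ, repClass (levelRep F 𝔽 n (k - i + t * m))) ∧
    ∀ (K : Type w) [Field K] [CharZero K]
      (θ : CommGroup.torsion (AlgebraicClosure F)ˣ →* K), Function.Injective θ →
      ∀ g : GL (Fin n) 𝔽, p.Coprime (orderOf g) →
        brauerCharacter θ (homologyRep F 𝔽 n m k i) g
          = ∑ᶠ t : ℤ, ((fixedCount 𝔽 n (k + t * m) g : K)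
            - (fixedCount 𝔽 n (k - i + t * m) g : K)) := by
  have hE : ExactOffMiddle m n (incidenceMap F 𝔽 n) (levelModule F 𝔽 n) :=
    hm ▸ exactOffMiddle_of_charP hpq n
  have hm0 : 0 < m := by
    have := (quantumChar_mem hpq).1
    omega
  have hfin : ∀ r : ℤ, {t : ℤ | levelModule F 𝔽 n (r + t * m) ≠ ⊥}.Finite := fun r =>
    (finite_setOf_mem_Icc n hm0 r).subset fun t ht => by
      by_contra hc
      exact ht (levelModule_eq_bot hc)
  have hclass := isAdditiveInvariant_repClass.homologyRep_eq hE hki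
  refine ⟨hfin, ?_, hclass, ?_⟩
  -- The trace formula itself gives membership, since each M_r is a permutation module on the
  -- r-dimensional subspaces.
  · rw [hclass]
    have hmem : ∀ r : ℤ, ∑ᶠ t : ℤ, repClass (levelRep F 𝔽 n (r + t * m))
        ∈ burnsideRing F (GL (Fin n) 𝔽) := fun r =>
      finsum_induction (· ∈ burnsideRing F (GL (Fin n) 𝔽)) (zero_mem _)
        (fun _ _ => add_mem) fun t => repClass_levelRep_mem_burnsideRing F 𝔽 n _
    exact sub_mem (hmem _) (hmem _)
  · intro K _ _ θ hθ g hg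
    have hg' : ((orderOf g : ℕ) : F) ≠ 0 := by
      rw [Ne, CharP.cast_eq_zero_iff F p]
      exact ((Fact.out (p := p.Prime)).coprime_iff_not_dvd).1 hg
    have hΦ := isAdditiveInvariant_brauerCharacter (G := GL (Fin n) 𝔽) θ g
    -- The fixed-point count is the Brauer character of the level module, hence zero wherever that
    -- module is; this makes the sums finite and allows them to be subtracted termwise.
    have hsupp : ∀ r : ℤ,
        (Function.support fun t : ℤ => (fixedCount 𝔽 n (r + t * m) g : K)).Finite := fun r =>
      (hfin r).subset fun t ht h0 => ht <| by
        change (fixedCount 𝔽 n (r + t * m) g : K) = 0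
        rw [← brauerCharacter_levelRep F 𝔽 n _ hθ g hg']
        exact hΦ.subrepresentation_eq_zero h0 _
    rw [finsum_sub_distrib (hsupp _) (hsupp _)]
    have h := hΦ.homologyRep_eq hE hki
    simpa only [brauerCharacter_levelRep F 𝔽 n _ hθ g hg'] using h
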